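/- A \emph{table of dimensions} is a sequence of integers $T=(i_1,\dots,i_n;\,i'_1,\dots,i'_{n-1})$, $n\ge 1$, with $i_k>i'_k$ and $i_{k+1}>i'_k$ (all $\ge 0$). Let $\mathbb G$ be the globular category, with objects $D_0,D_1,\dots$, generated by $\sigma_i,\tau_i:D_{i-1}\to D_i$ ($i \ge 1$) subject to $\sigma_{i+1}\sigma_i=\tau_{i+1}\sigma_i$ and $\sigma_{i+1}\tau_i=\tau_{i+1}\tau_i$; write $\sigma^i_j,\tau^i_j:D_j\to D_i$ for the iterated morphisms. In a category under $\mathbb G$, the \emph{globular sum} of $T$ is the colimit $D_{i_1}\amalg_{D_{i'_1}}D_{i_2}\amalg_{D_{i'_2}}\cdots\amalg_{D_{i'_{n-1}}}D_{i_n}$ of the diagram in which $D_{i'_k}$ maps to $D_{i_k}$ by $\sigma^{i_k}_{i'_k}$ and to $D_{i_{k+1}}$ by $\tau^{i_{k+1}}_{i'_k}$. For each $T$ let $S_T$ be its globular sum in the category $\widehat{\mathbb G}$ of globular sets (presheaves of sets on $\mathbb G$); globular sets isomorphic to some $S_T$ are called \emph{globular pasting schemes}, and $\Theta_0\subset\widehat{\mathbb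 G}$ is the full subcategory on the $S_T$. A \emph{strict $\infty$-groupoid} is a globular set $X=(X_i)_{i\ge0}$, with iterated sources and targets $s^i_j,t^i_j:X_i\to X_j$, endowed with compositions $u*^i_jv\in X_i$ for $u,v\in X_i$ with $s^i_j(u)=t^i_j(v)$, inverses $w^i_j:X_i\to X_i$ ($i>j\ge0$) and units $k_i:X_i\to X_{i+1}$, with the usual sources and targets, such that the compositions are associative and unital, satisfy the exchange law, $k_i$ is compatible with compositions, and $w^i_j(u)$ is a two-sided $*^i_j$-inverse of $u$. It is \emph{free} on a globular set $P$ if it is endowed with a morphism of globular sets from $P$ which is universal among morphisms from $P$ to strict $\infty$-groupoids. A \emph{groupoidal globular extension} is a category $C$ with a functor $\Theta_0\to C$ sending the $S_T$, with their canonical cocones, to globular sums in $C$, together with morphisms $\nabla^i_j:D_i\to D_i\amalg_{D_j}D_i$ and $\omega^i_j:D_i\to D_i$ ($i>j\ge0$) and $\kappa_i:D_{i+1}\to D_i$ ($i\ge0$) satisfying the duals of the source and target conditions and of the axioms (associativity, exchange, unit laws, functoriality of units, left and right inverses) for the operations $*^i_j$, $w^i_j$ and $k_i$ of a strict $\infty$-groupoid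 (so that $\nabla^i_j$, $\omega^i_j$ and $\kappa_i$ are dual to $*^i_j$, $w^i_j$ and $k_i$). Let $\widetilde\Theta$ be the universal groupoidal globular extension: every groupoidal globular extension structure on a category $C$ is induced by a unique functor $\widetilde\Theta\to C$. It has the same objects as $\Theta_0$. Let $\mathrm{Mod}(\widetilde\Theta)$ be the category of \emph{models} of $\widetilde\Theta$, i.e. presheaves of sets on $\widetilde\Theta$ sending globular sums to the corresponding limits. The category $\infty\text{-}\mathrm{Grpd}$ has as objects the strict $\infty$-groupoids, and as morphisms the morphisms of globular sets compatible with compositions, units and inverses. The restriction to $\mathbb G$ of a model $X$ is a strict $\infty$-groupoid with $*^i_j=X(\nabla^i_j)$, $k_i=X(\kappa_i)$, $w^i_j=X(\omega^i_j)$; this gives a functor $\mathrm{Mod}(\widetilde\Theta)\to\infty\text{-}\mathrm{Grpd}$. \textbf{Proposition.} The composite functor \[ \widetilde\Theta\longrightarrow \mathrm{Mod}(\widetilde\Theta)\longrightarrow\infty\text{-}\mathrm{Grpd}, \] whose first factor is the Yoneda functor, is fully faithful, and it sends the object of $\widetilde\Theta$ corresponding to a table of dimensions $T$ to a free strict $\infty$-groupoid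 on the globular set $S_T$. Its essential image consists exactly of the free strict $\infty$-groupoids on globular pasting schemes. Hence it induces an equivalence between $\widetilde\Theta$ and the full subcategory of $\infty\text{-}\mathrm{Grpd}$ whose objects are the free strict $\infty$-groupoids on globular pasting schemes. -/

import Mathlib

open CategoryTheory Limits Opposite

namespace Globular

universe v u

/-! ### The globular category and globular sets -/

/-- Morphisms `D_j ⟶ D_i` of the globular category: the identities and, for `j < i`, the two
morphisms `σ^i_j` and `τ^i_j`. -/
inductive GlobeHom : ℕ → ℕ → Type
  | id (i : ℕ) : GlobeHom i i
  | src {j i : ℕ} (h : j < i) : GlobeHom j i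
  | tgt {j i : ℕ} (h : j < i) : GlobeHom j i

namespace GlobeHom

theorem le {j i : ℕ} : GlobeHom j i → j ≤ i
  | id _ => le_rfl
  | src h => h.le
  | tgt h => h.le

/-- Composition (in diagrammatic order).  The coglobular relations
`σ_{i+1} σ_i = τ_{i+1} σ_i` and `σ_{i+1} τ_i = τ_{i+1} τ_i` say that a composite of generators
only depends on the generator that is applied first. -/
def comp : {k j i : ℕ} → GlobeHom k j → GlobeHom j i → GlobeHom k i
  | _, _, _, id _, g => g
  | _, _, _, src h, g => src (lt_of_lt_of_le h g.le)
  | _, _, _, tgt h, g => tgt (lt_of_lt_of_le h g.le)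

theorem comp_id {j i : ℕ} (f : GlobeHom j i) : f.comp (id i) = f := by cases f <;> rfl

theorem assoc {l k j i : ℕ} (f : GlobeHom l k) (g : GlobeHom k j) (h : GlobeHom j i) :
    (f.comp g).comp h = f.comp (g.comp h) := by cases f <;> rfl

end GlobeHom

/-- The globular category `𝔾`, with objects `D_0, D_1, D_2, …`. -/
structure Globe : Type where
  dim : ℕ

instance : Category Globe where
  Hom X Y := GlobeHom X.dim Y.dim
  id X := GlobeHom.id X.dim
  comp f g := GlobeHom.comp f g
  id_comp _ := rfl
  comp_id := GlobeHom.comp_id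
  assoc := GlobeHom.assoc

/-- `σ^i_j : D_j ⟶ D_i`. -/
def Globe.σ {j i : ℕ} (h : j < i) : Globe.mk j ⟶ Globe.mk i := GlobeHom.src h

/-- `τ^i_j : D_j ⟶ D_i`. -/
def Globe.τ {j i : ℕ} (h : j < i) : Globe.mk j ⟶ Globe.mk i := GlobeHom.tgt h

/-- Globular sets: presheaves on `𝔾`. -/
abbrev GlobularSet := Globeᵒᵖ ⥤ Type

namespace GlobularSet

variable (X : GlobularSet)

/-- The set `X_i` of `i`-arrows. -/
abbrev cell (i : ℕ) : Type := X.obj (op (Globe.mk i))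

/-- The iterated source `s^i_j : X_i → X_j`. -/
def src {j i : ℕ} (h : j < i) (u : X.cell i) : X.cell j := X.map (Globe.σ h).op u

/-- The iterated target `t^i_j : X_i → X_j`. -/
def tgt {j i : ℕ} (h : j < i) (u : X.cell i) : X.cell j := X.map (Globe.τ h).op u

variable {X} {k j i : ℕ}

theorem src_src (h : k < j) (h' : j < i) (u : X.cell i) :
    X.src h (X.src h' u) = X.src (h.trans h') u :=
  (X.map_comp_apply (Globe.σ h').op (Globe.σ h).op u).symm

theorem src_tgt (h : k < j) (h' : j < i) (u : X.cell i) :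
    X.src h (X.tgt h' u) = X.src (h.trans h') u :=
  (X.map_comp_apply (Globe.τ h').op (Globe.σ h).op u).symm

theorem tgt_src (h : k < j) (h' : j < i) (u : X.cell i) :
    X.tgt h (X.src h' u) = X.tgt (h.trans h') u :=
  (X.map_comp_apply (Globe.σ h').op (Globe.τ h).op u).symm

theorem tgt_tgt (h : k < j) (h' : j < i) (u : X.cell i) :
    X.tgt h (X.tgt h' u) = X.tgt (h.trans h') u :=
  (X.map_comp_apply (Globe.τ h').op (Globe.τ h).op u).symm

theorem app_src {X Y : GlobularSet} (f : X ⟶ Y) (h : j < i) (u : X.cell i) :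
    f.app _ (X.src h u) = Y.src h (f.app _ u) :=
  NatTrans.naturality_apply f (Globe.σ h).op u

theorem app_tgt {X Y : GlobularSet} (f : X ⟶ Y) (h : j < i) (u : X.cell i) :
    f.app _ (X.tgt h u) = Y.tgt h (f.app _ u) :=
  NatTrans.naturality_apply f (Globe.τ h).op u

end GlobularSet

/-! ### Strict ∞-groupoids -/

/-- The structure of an ∞-precategory on a globular set. The composite `u *^i_j v` is defined
when `s^i_j u = t^i_j v`. -/
structure InfPrecategory (X : GlobularSet) where
  comp : ∀ {j i : ℕ} (h : j < i) (u v : X.cell i), X.src h u = X.tgt h v → X.cell i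
  unit : ∀ i : ℕ, X.cell i → X.cell (i + 1)
  src_comp_self : ∀ (i : ℕ) (u v : X.cell (i + 1)) (w : X.src i.lt_succ_self u = X.tgt _ v),
    X.src i.lt_succ_self (comp i.lt_succ_self u v w) = X.src i.lt_succ_self v
  tgt_comp_self : ∀ (i : ℕ) (u v : X.cell (i + 1)) (w : X.src i.lt_succ_self u = X.tgt _ v),
    X.tgt i.lt_succ_self (comp i.lt_succ_self u v w) = X.tgt i.lt_succ_self u
  src_comp_lt : ∀ {j i : ℕ} (h : j < i) (u v : X.cell (i + 1))
    (w : X.src (h.trans i.lt_succ_self) u = X.tgt _ v),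
    X.src i.lt_succ_self (comp (h.trans i.lt_succ_self) u v w) =
      comp h (X.src i.lt_succ_self u) (X.src i.lt_succ_self v)
        (by rw [GlobularSet.src_src, GlobularSet.tgt_src, w])
  tgt_comp_lt : ∀ {j i : ℕ} (h : j < i) (u v : X.cell (i + 1))
    (w : X.src (h.trans i.lt_succ_self) u = X.tgt _ v),
    X.tgt i.lt_succ_self (comp (h.trans i.lt_succ_self) u v w) =
      comp h (X.tgt i.lt_succ_self u) (X.tgt i.lt_succ_self v)
        (by rw [GlobularSet.src_tgt, GlobularSet.tgt_tgt, w])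
  src_unit : ∀ (i : ℕ) (u : X.cell i), X.src i.lt_succ_self (unit i u) = u
  tgt_unit : ∀ (i : ℕ) (u : X.cell i), X.tgt i.lt_succ_self (unit i u) = u

namespace InfPrecategory

variable {X : GlobularSet} (P : InfPrecategory X)

/-- The iterated unit `k^i_j : X_j → X_i`. -/
def units {j i : ℕ} (h : j ≤ i) (u : X.cell j) : X.cell i :=
  Nat.leRecOn h (fun {n} => P.unit n) u

theorem units_self {j : ℕ} (u : X.cell j) : P.units le_rfl u = u := Nat.leRecOn_self u

theorem units_succ {j i : ℕ} (h : j ≤ i) (u : X.cell j) :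
    P.units (h.trans i.le_succ) u = P.unit i (P.units h u) := Nat.leRecOn_succ h u

theorem comp_congr {j i : ℕ} (h : j < i) {u u' v v' : X.cell i} (hu : u = u') (hv : v = v')
    (w : X.src h u = X.tgt h v) :
    P.comp h u v w = P.comp h u' v' (by rw [← hu, ← hv, w]) := by
  subst hu hv; rfl

/-- `s^i_j (u *^i_j v) = s^i_j v`. -/
theorem src_comp {j i : ℕ} (h : j < i) (u v : X.cell i) (w : X.src h u = X.tgt h v) :
    X.src h (P.comp h u v w) = X.src h v := by
  induction i with
  | zero => omega
  | succ i ih =>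
    rcases Nat.lt_succ_iff_lt_or_eq.1 h with h' | rfl
    · rw [← GlobularSet.src_src h' i.lt_succ_self, P.src_comp_lt h', ih, GlobularSet.src_src]
    · exact P.src_comp_self _ u v w

/-- `t^i_j (u *^i_j v) = t^i_j u`. -/
theorem tgt_comp {j i : ℕ} (h : j < i) (u v : X.cell i) (w : X.src h u = X.tgt h v) :
    X.tgt h (P.comp h u v w) = X.tgt h u := by
  induction i with
  | zero => omega
  | succ i ih =>
    rcases Nat.lt_succ_iff_lt_or_eq.1 h with h' | rfl
    · rw [← GlobularSet.tgt_tgt h' i.lt_succ_self, P.tgt_comp_lt h', ih, GlobularSet.tgt_tgt]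
    · exact P.tgt_comp_self _ u v w

/-- `s^i_j (u *^i_k v) = s^i_j u *^j_k s^i_j v` for `k < j < i`. -/
theorem src_comp_high {k j i : ℕ} (hkj : k < j) (h : j < i) (u v : X.cell i)
    (w : X.src (hkj.trans h) u = X.tgt (hkj.trans h) v) :
    X.src h (P.comp (hkj.trans h) u v w) =
      P.comp hkj (X.src h u) (X.src h v)
        (by rw [GlobularSet.src_src, GlobularSet.tgt_src, w]) := by
  induction i with
  | zero => omega
  | succ i ih =>
    rcases Nat.lt_succ_iff_lt_or_eq.1 h with h' | rfl
    · rw [← GlobularSet.src_src h' i.lt_succ_self, P.src_comp_lt (hkj.trans h'), ih h']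
      exact P.comp_congr hkj (GlobularSet.src_src _ _ _) (GlobularSet.src_src _ _ _) _
    · exact P.src_comp_lt hkj u v w

/-- `t^i_j (u *^i_k v) = t^i_j u *^j_k t^i_j v` for `k < j < i`. -/
theorem tgt_comp_high {k j i : ℕ} (hkj : k < j) (h : j < i) (u v : X.cell i)
    (w : X.src (hkj.trans h) u = X.tgt (hkj.trans h) v) :
    X.tgt h (P.comp (hkj.trans h) u v w) =
      P.comp hkj (X.tgt h u) (X.tgt h v)
        (by rw [GlobularSet.src_tgt, GlobularSet.tgt_tgt, w]) := by
  induction i with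
  | zero => omega
  | succ i ih =>
    rcases Nat.lt_succ_iff_lt_or_eq.1 h with h' | rfl
    · rw [← GlobularSet.tgt_tgt h' i.lt_succ_self, P.tgt_comp_lt (hkj.trans h'), ih h']
      exact P.comp_congr hkj (GlobularSet.tgt_tgt _ _ _) (GlobularSet.tgt_tgt _ _ _) _
    · exact P.tgt_comp_lt hkj u v w

/-- `s^i_k (u *^i_j v) = s^i_k u` for `k < j < i`. -/
theorem src_comp_low {k j i : ℕ} (hkj : k < j) (h : j < i) (u v : X.cell i)
    (w : X.src h u = X.tgt h v) :
    X.src (hkj.trans h) (P.comp h u v w) = X.src (hkj.trans h) u := by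
  rw [← GlobularSet.src_tgt hkj h, P.tgt_comp, GlobularSet.src_tgt]

/-- `t^i_k (u *^i_j v) = t^i_k u` for `k < j < i`. -/
theorem tgt_comp_low {k j i : ℕ} (hkj : k < j) (h : j < i) (u v : X.cell i)
    (w : X.src h u = X.tgt h v) :
    X.tgt (hkj.trans h) (P.comp h u v w) = X.tgt (hkj.trans h) u := by
  rw [← GlobularSet.tgt_tgt hkj h, P.tgt_comp, GlobularSet.tgt_tgt]

theorem src_units {j i : ℕ} (h : j < i) (u : X.cell j) : X.src h (P.units h.le u) = u := by
  induction i with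
  | zero => omega
  | succ i ih =>
    rcases Nat.lt_succ_iff_lt_or_eq.1 h with h' | rfl
    · rw [P.units_succ h'.le, ← GlobularSet.src_src h' i.lt_succ_self, P.src_unit, ih]
    · rw [P.units_succ le_rfl, P.src_unit, P.units_self]

theorem tgt_units {j i : ℕ} (h : j < i) (u : X.cell j) : X.tgt h (P.units h.le u) = u := by
  induction i with
  | zero => omega
  | succ i ih =>
    rcases Nat.lt_succ_iff_lt_or_eq.1 h with h' | rfl
    · rw [P.units_succ h'.le, ← GlobularSet.tgt_tgt h' i.lt_succ_self, P.tgt_unit, ih]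
    · rw [P.units_succ le_rfl, P.tgt_unit, P.units_self]

/-- The axioms of strict ∞-categories: associativity, exchange law, unit laws, and functoriality
of units. -/
structure IsStrictCategory : Prop where
  ass : ∀ {j i : ℕ} (h : j < i) (u v w : X.cell i)
    (huv : X.src h u = X.tgt h v) (hvw : X.src h v = X.tgt h w),
    P.comp h (P.comp h u v huv) w (by rw [P.src_comp, hvw]) =
      P.comp h u (P.comp h v w hvw) (by rw [P.tgt_comp, huv])
  exc : ∀ {k j i : ℕ} (hkj : k < j) (hji : j < i) (u u' v v' : X.cell i)
    (hu : X.src hji u = X.tgt hji u') (huv : X.src (hkj.trans hji) u' = X.tgt (hkj.trans hji) v)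
    (hv : X.src hji v = X.tgt hji v'),
    P.comp (hkj.trans hji) (P.comp hji u u' hu) (P.comp hji v v' hv)
        (by rw [← GlobularSet.src_src hkj hji, P.src_comp, GlobularSet.src_src,
          P.tgt_comp_low hkj, huv]) =
      P.comp hji
        (P.comp (hkj.trans hji) u v (by
          rw [← huv, ← GlobularSet.src_src hkj hji, hu, GlobularSet.src_tgt]))
        (P.comp (hkj.trans hji) u' v' (by
          rw [huv, ← GlobularSet.tgt_src hkj hji, hv, GlobularSet.tgt_tgt]))
        (by
          rw [P.src_comp_high hkj hji, P.tgt_comp_high hkj hji]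
          exact P.comp_congr hkj hu hv _)
  lun : ∀ {j i : ℕ} (h : j < i) (u : X.cell i),
    P.comp h (P.units h.le (X.tgt h u)) u (P.src_units h _) = u
  run : ∀ {j i : ℕ} (h : j < i) (u : X.cell i),
    P.comp h u (P.units h.le (X.src h u)) (P.tgt_units h _).symm = u
  fun_unit : ∀ {j i : ℕ} (h : j < i) (u v : X.cell i) (w : X.src h u = X.tgt h v),
    P.unit i (P.comp h u v w) =
      P.comp (h.trans i.lt_succ_self) (P.unit i u) (P.unit i v)
        (by rw [← GlobularSet.src_src h i.lt_succ_self, P.src_unit,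
          ← GlobularSet.tgt_tgt h i.lt_succ_self, P.tgt_unit, w])

end InfPrecategory

/-- The structure of an ∞-pregroupoid on a globular set. -/
structure InfPregroupoid (X : GlobularSet) extends InfPrecategory X where
  inv : ∀ {j i : ℕ}, j < i → X.cell i → X.cell i
  src_inv_self : ∀ (i : ℕ) (u : X.cell (i + 1)),
    X.src i.lt_succ_self (inv i.lt_succ_self u) = X.tgt i.lt_succ_self u
  tgt_inv_self : ∀ (i : ℕ) (u : X.cell (i + 1)),
    X.tgt i.lt_succ_self (inv i.lt_succ_self u) = X.src i.lt_succ_self u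
  src_inv_lt : ∀ {j i : ℕ} (h : j < i) (u : X.cell (i + 1)),
    X.src i.lt_succ_self (inv (h.trans i.lt_succ_self) u) = inv h (X.src i.lt_succ_self u)
  tgt_inv_lt : ∀ {j i : ℕ} (h : j < i) (u : X.cell (i + 1)),
    X.tgt i.lt_succ_self (inv (h.trans i.lt_succ_self) u) = inv h (X.tgt i.lt_succ_self u)

namespace InfPregroupoid

variable {X : GlobularSet} (P : InfPregroupoid X)

theorem src_inv {j i : ℕ} (h : j < i) (u : X.cell i) : X.src h (P.inv h u) = X.tgt h u := by
  induction i with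
  | zero => omega
  | succ i ih =>
    rcases Nat.lt_succ_iff_lt_or_eq.1 h with h' | rfl
    · rw [← GlobularSet.src_src h' i.lt_succ_self, P.src_inv_lt h', ih, GlobularSet.tgt_src]
    · exact P.src_inv_self _ u

theorem tgt_inv {j i : ℕ} (h : j < i) (u : X.cell i) : X.tgt h (P.inv h u) = X.src h u := by
  induction i with
  | zero => omega
  | succ i ih =>
    rcases Nat.lt_succ_iff_lt_or_eq.1 h with h' | rfl
    · rw [← GlobularSet.tgt_tgt h' i.lt_succ_self, P.tgt_inv_lt h', ih, GlobularSet.src_tgt]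
    · exact P.tgt_inv_self _ u

/-- The axioms of strict ∞-groupoids: those of strict ∞-categories, and that `w^i_j u` is a left
and a right inverse of `u` for `*^i_j`. -/
structure IsStrictGroupoid : Prop extends P.toInfPrecategory.IsStrictCategory where
  linv : ∀ {j i : ℕ} (h : j < i) (u : X.cell i),
    P.comp h (P.inv h u) u (P.src_inv h u) = P.units h.le (X.src h u)
  rinv : ∀ {j i : ℕ} (h : j < i) (u : X.cell i),
    P.comp h u (P.inv h u) (P.tgt_inv h u).symm = P.units h.le (X.tgt h u)

end InfPregroupoid

/-- Strict ∞-groupoids. -/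
structure StrictInfGroupoid where
  cells : GlobularSet
  str : InfPregroupoid cells
  isStrict : str.IsStrictGroupoid

namespace StrictInfGroupoid

/-- Morphisms of strict ∞-groupoids: morphisms of globular sets compatible with compositions,
units and inverses. -/
@[ext]
structure Hom (X Y : StrictInfGroupoid) where
  map : X.cells ⟶ Y.cells
  map_comp : ∀ {j i : ℕ} (h : j < i) (u v : X.cells.cell i) (w : X.cells.src h u = X.cells.tgt h v),
    map.app _ (X.str.comp h u v w) = Y.str.comp h (map.app _ u) (map.app _ v)
      (by rw [← GlobularSet.app_src, ← GlobularSet.app_tgt, w])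
  map_unit : ∀ (i : ℕ) (u : X.cells.cell i), map.app _ (X.str.unit i u) = Y.str.unit i (map.app _ u)
  map_inv : ∀ {j i : ℕ} (h : j < i) (u : X.cells.cell i),
    map.app _ (X.str.inv h u) = Y.str.inv h (map.app _ u)

instance : Category StrictInfGroupoid where
  Hom := Hom
  id X := ⟨𝟙 _, fun _ _ _ _ => rfl, fun _ _ => rfl, fun _ _ => rfl⟩
  comp {X Y Z} f g := ⟨f.map ≫ g.map,
    fun h u v w => (congrArg (g.map.app _) (f.map_comp h u v w)).trans (g.map_comp h _ _ _),
    fun i u => (congrArg (g.map.app _) (f.map_unit i u)).trans (g.map_unit i _),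
    fun h u => (congrArg (g.map.app _) (f.map_inv h u)).trans (g.map_inv h _)⟩

/-- The underlying globular set of a strict ∞-groupoid. -/
def forget : StrictInfGroupoid ⥤ GlobularSet where
  obj X := X.cells
  map f := Hom.map f

/-- `Y` is a free strict ∞-groupoid on the globular set `P`: there is a morphism `P ⟶ U Y` which is
universal among the morphisms from `P` to underlying globular sets of strict ∞-groupoids. -/
def IsFreeOn (P : GlobularSet) (Y : StrictInfGroupoid) : Prop :=
  ∃ η : P ⟶ forget.obj Y, Nonempty (IsInitial (StructuredArrow.mk η))

end StrictInfGroupoid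
/-! ### Tables of dimensions, globular sums and `Θ₀` -/

/-- Tables of dimensions (of width `n + 1`): the upper row is `i_1, …, i_{n+1}`, the lower row is
`i'_1, …, i'_n`. -/
structure Table : Type where
  n : ℕ
  top : Fin (n + 1) → ℕ
  bot : Fin n → ℕ
  lt_left : ∀ l, bot l < top l.castSucc
  lt_right : ∀ l, bot l < top l.succ

namespace Table

/-- The shape of the diagram `• ← • → • ← • → ⋯ ← • → •` attached to a table. -/
def shape (T : Table) : MultispanShape where
  L := Fin T.n
  R := Fin (T.n + 1)
  fst := Fin.castSucc
  snd := Fin.succ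

/-- The diagram whose colimit is the globular sum attached to the table `T`, in a category `C` under
`𝔾`: the object `D_{i'_l}` maps to `D_{i_l}` by `σ` and to `D_{i_{l+1}}` by `τ`. -/
def diagram (T : Table) {C : Type u} [Category.{v} C] (F : Globe ⥤ C) :
    MultispanIndex T.shape C where
  left l := F.obj ⟨T.bot l⟩
  right k := F.obj ⟨T.top k⟩
  fst l := F.map (Globe.σ (T.lt_left l))
  snd l := F.map (Globe.τ (T.lt_right l))

/-- The globular pasting scheme `S_T`: the globular sum of `T` in the category of globular sets. -/
noncomputable def pastingScheme (T : Table) : GlobularSet :=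
  multicoequalizer (T.diagram yoneda)

/-- The canonical morphism `D_{i_k} ⟶ S_T`. -/
noncomputable def inj (T : Table) (k : Fin (T.n + 1)) :
    yoneda.obj ⟨T.top k⟩ ⟶ T.pastingScheme :=
  Multicoequalizer.π (T.diagram yoneda) k

theorem inj_glue (T : Table) (l : Fin T.n) :
    yoneda.map (Globe.σ (T.lt_left l)) ≫ T.inj l.castSucc =
      yoneda.map (Globe.τ (T.lt_right l)) ≫ T.inj l.succ :=
  Multicoequalizer.condition (T.diagram yoneda) l

noncomputable def desc (T : Table) {X : GlobularSet} (f : ∀ k, yoneda.obj ⟨T.top k⟩ ⟶ X)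
    (w : ∀ l : Fin T.n, yoneda.map (Globe.σ (T.lt_left l)) ≫ f l.castSucc =
      yoneda.map (Globe.τ (T.lt_right l)) ≫ f l.succ) : T.pastingScheme ⟶ X :=
  Multicoequalizer.desc (T.diagram yoneda) X f w

theorem inj_desc (T : Table) {X : GlobularSet} (f : ∀ k, yoneda.obj ⟨T.top k⟩ ⟶ X)
    (w : ∀ l : Fin T.n, yoneda.map (Globe.σ (T.lt_left l)) ≫ f l.castSucc =
      yoneda.map (Globe.τ (T.lt_right l)) ≫ f l.succ) (k : Fin (T.n + 1)) :
    T.inj k ≫ T.desc f w = f k :=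
  Multicoequalizer.π_desc (T.diagram yoneda) X f w k

theorem hom_ext (T : Table) {X : GlobularSet} {f g : T.pastingScheme ⟶ X}
    (h : ∀ k, T.inj k ≫ f = T.inj k ≫ g) : f = g :=
  Multicoequalizer.hom_ext (T.diagram yoneda) f g h

/-- The table of width `1` with upper row `i`. -/
abbrev single (i : ℕ) : Table where
  n := 0
  top _ := i
  bot := Fin.elim0
  lt_left l := l.elim0
  lt_right l := l.elim0

/-- The table with upper row `i, i` and lower row `j`. -/
abbrev double {j i : ℕ} (h : j < i) : Table where
  n := 1
  top _ := i
  bot _ := j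
  lt_left _ := h
  lt_right _ := h

/-- The table with upper row `i, i, i` and lower row `j, j`. -/
abbrev triple {j i : ℕ} (h : j < i) : Table where
  n := 2
  top _ := i
  bot _ := j
  lt_left _ := h
  lt_right _ := h

/-- The table with upper row `i, i, i, i` and lower row `j, k, j`. -/
abbrev quadruple {k j i : ℕ} (hkj : k < j) (hji : j < i) : Table where
  n := 3
  top _ := i
  bot := ![j, k, j]
  lt_left l := by fin_cases l <;> simp <;> omega
  lt_right l := by fin_cases l <;> simp <;> omega

/-- The canonical isomorphism from the representable globular set `D_i` to the globular sum of
the table of width `1` with upper row `i`. -/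
noncomputable def diskInj (i : ℕ) : yoneda.obj ⟨i⟩ ⟶ (single i).pastingScheme :=
  (single i).inj 0

noncomputable def diskDesc {i : ℕ} {X : GlobularSet} (f : yoneda.obj ⟨i⟩ ⟶ X) :
    (single i).pastingScheme ⟶ X :=
  (single i).desc (fun _ => f) (fun l => l.elim0)

theorem diskInj_desc {i : ℕ} {X : GlobularSet} (f : yoneda.obj ⟨i⟩ ⟶ X) :
    diskInj i ≫ diskDesc f = f :=
  (single i).inj_desc _ _ 0

theorem disk_hom_ext {i : ℕ} {X : GlobularSet} {f g : (single i).pastingScheme ⟶ X}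
    (h : diskInj i ≫ f = diskInj i ≫ g) : f = g :=
  (single i).hom_ext fun k => by
    obtain rfl : k = 0 := Subsingleton.elim (α := Fin 1) _ _
    exact h

end Table

/-- The category `Θ₀`, as the full subcategory of the category of globular sets with objects the
globular pasting schemes `S_T`, indexed by the tables of dimensions `T`. -/
abbrev Theta0 := InducedCategory GlobularSet Table.pastingScheme

/-- The inclusion of `Θ₀` into globular sets. -/
noncomputable abbrev Theta0.toGlobularSet : Theta0 ⥤ GlobularSet :=
  inducedFunctor Table.pastingScheme

namespace Theta0

/-- The object `D_i` of `Θ₀`. -/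
abbrev disk (i : ℕ) : Theta0 := Table.single i

/-- The canonical functor `𝔾 ⥤ Θ₀`, `D_i ↦ D_i`. -/
noncomputable def ofGlobe : Globe ⥤ Theta0 where
  obj X := disk X.dim
  map f := InducedCategory.homMk (Table.diskDesc (yoneda.map f ≫ Table.diskInj _))
  map_id X := InducedCategory.hom_ext (Table.disk_hom_ext (by
    simp [Table.diskInj_desc]))
  map_comp f g := InducedCategory.hom_ext (Table.disk_hom_ext (by
    simp only [InducedCategory.comp_hom, InducedCategory.homMk_hom]
    rw [Table.diskInj_desc, ← Category.assoc, Table.diskInj_desc, Category.assoc,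
      Table.diskInj_desc, Functor.map_comp, Category.assoc]))

/-- `σ^i_j : D_j ⟶ D_i` in `Θ₀`. -/
noncomputable def σ {j i : ℕ} (h : j < i) : disk j ⟶ disk i := ofGlobe.map (Globe.σ h)

/-- `τ^i_j : D_j ⟶ D_i` in `Θ₀`. -/
noncomputable def τ {j i : ℕ} (h : j < i) : disk j ⟶ disk i := ofGlobe.map (Globe.τ h)

theorem σ_σ {k j i : ℕ} (h : k < j) (h' : j < i) : σ h ≫ σ h' = σ (h.trans h') :=
  (ofGlobe.map_comp (Globe.σ h) (Globe.σ h')).symm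

theorem σ_τ {k j i : ℕ} (h : k < j) (h' : j < i) : σ h ≫ τ h' = σ (h.trans h') :=
  (ofGlobe.map_comp (Globe.σ h) (Globe.τ h')).symm

theorem τ_σ {k j i : ℕ} (h : k < j) (h' : j < i) : τ h ≫ σ h' = τ (h.trans h') :=
  (ofGlobe.map_comp (Globe.τ h) (Globe.σ h')).symm

theorem τ_τ {k j i : ℕ} (h : k < j) (h' : j < i) : τ h ≫ τ h' = τ (h.trans h') :=
  (ofGlobe.map_comp (Globe.τ h) (Globe.τ h')).symm

/-- The canonical morphism `ε_k : D_{i_k} ⟶ S_T` in `Θ₀`. -/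
noncomputable def ε (T : Table) (k : Fin (T.n + 1)) :
    disk (T.top k) ⟶ (T : Theta0) :=
  InducedCategory.homMk (Table.diskDesc (T.inj k))

theorem ε_glue (T : Table) (l : Fin T.n) :
    σ (T.lt_left l) ≫ ε T l.castSucc = τ (T.lt_right l) ≫ ε T l.succ :=
  InducedCategory.hom_ext (Table.disk_hom_ext (by
    simp only [σ, τ, ε, ofGlobe, InducedCategory.comp_hom, InducedCategory.homMk_hom]
    rw [← Category.assoc, Table.diskInj_desc, Category.assoc, Table.diskInj_desc,
      ← Category.assoc, Table.diskInj_desc, Category.assoc, Table.diskInj_desc, Table.inj_glue]))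

end Theta0

/-! ### Globular extensions under `Θ₀` and their models -/

open Theta0

section Extensions

variable {C : Type u} [Category.{v} C]

/-- The image under `K : Θ₀ ⥤ C` of the colimit cocone exhibiting `S_T` as a globular sum. -/
noncomputable def sumCofork (K : Theta0 ⥤ C) (T : Table) :
    Multicofork (T.diagram (ofGlobe ⋙ K)) :=
  Multicofork.ofπ _ (K.obj T) (fun k => K.map (ε T k)) fun l => by
    have := congrArg (fun f => K.map f) (ε_glue T l)
    simp only [K.map_comp] at this
    exact this

/-- The functor `K : Θ₀ ⥤ C` makes `C` a globular extension under `Θ₀`: for each table of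
dimensions `T`, the object `K S_T` is the globular sum attached to `T` in `C`. -/
def IsGlobularExtension (K : Theta0 ⥤ C) : Prop :=
  ∀ T : Table, Nonempty (IsColimit (sumCofork K T))

namespace IsGlobularExtension

variable {K : Theta0 ⥤ C} (hK : IsGlobularExtension K)

/-- The morphism out of a globular sum with given components. -/
noncomputable def desc (T : Table) {Y : C} (f : ∀ k, K.obj (disk (T.top k)) ⟶ Y)
    (w : ∀ l : Fin T.n, K.map (σ (T.lt_left l)) ≫ f l.castSucc =
      K.map (τ (T.lt_right l)) ≫ f l.succ) : K.obj T ⟶ Y :=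
  Multicofork.IsColimit.desc (hK T).some f w

theorem fac (T : Table) {Y : C} (f : ∀ k, K.obj (disk (T.top k)) ⟶ Y)
    (w : ∀ l : Fin T.n, K.map (σ (T.lt_left l)) ≫ f l.castSucc =
      K.map (τ (T.lt_right l)) ≫ f l.succ) (k : Fin (T.n + 1)) :
    K.map (ε T k) ≫ hK.desc T f w = f k :=
  Multicofork.IsColimit.fac (hK T).some f w k

theorem hom_ext {K : Theta0 ⥤ C} (hK : IsGlobularExtension K) (T : Table) {Y : C} {f g : K.obj T ⟶ Y}
    (h : ∀ k, K.map (ε T k) ≫ f = K.map (ε T k) ≫ g) : f = g :=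
  Multicofork.IsColimit.hom_ext (hK T).some h

/-- The morphism `(f, g) : D_i ⨿_{D_j} D_i ⟶ Y`. -/
noncomputable def pair {j i : ℕ} (h : j < i) {Y : C} (f g : K.obj (disk i) ⟶ Y)
    (w : K.map (σ h) ≫ f = K.map (τ h) ≫ g) : K.obj (Table.double h) ⟶ Y :=
  hK.desc (Table.double h) ![f, g] fun l => by
    obtain rfl : l = 0 := Subsingleton.elim (α := Fin 1) _ _
    exact w

theorem fst_pair {j i : ℕ} (h : j < i) {Y : C} (f g : K.obj (disk i) ⟶ Y)
    (w : K.map (σ h) ≫ f = K.map (τ h) ≫ g) : K.map (ε (.double h) 0) ≫ hK.pair h f g w = f :=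
  hK.fac (Table.double h) ![f, g] _ 0

theorem snd_pair {j i : ℕ} (h : j < i) {Y : C} (f g : K.obj (disk i) ⟶ Y)
    (w : K.map (σ h) ≫ f = K.map (τ h) ≫ g) : K.map (ε (.double h) 1) ≫ hK.pair h f g w = g :=
  hK.fac (Table.double h) ![f, g] _ 1

theorem pair_ext {K : Theta0 ⥤ C} (hK : IsGlobularExtension K) {j i : ℕ} (h : j < i) {Y : C} {f g : K.obj (Table.double h) ⟶ Y}
    (h₁ : K.map (ε (.double h) 0) ≫ f = K.map (ε (.double h) 0) ≫ g)
    (h₂ : K.map (ε (.double h) 1) ≫ f = K.map (ε (.double h) 1) ≫ g) : f = g :=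
  hK.hom_ext (Table.double h) (Fin.forall_fin_two.2 ⟨h₁, h₂⟩)

theorem pair_comp {j i : ℕ} (h : j < i) {Y Z : C} (f g : K.obj (disk i) ⟶ Y)
    (w : K.map (σ h) ≫ f = K.map (τ h) ≫ g) (m : Y ⟶ Z) :
    hK.pair h f g w ≫ m = hK.pair h (f ≫ m) (g ≫ m)
      (by rw [← Category.assoc, w, Category.assoc]) := by
  apply hK.pair_ext h
  · rw [← Category.assoc, fst_pair, fst_pair]
  · rw [← Category.assoc, snd_pair, snd_pair]

end IsGlobularExtension

section Relations

variable (K : Theta0 ⥤ C) {k j i : ℕ}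

theorem map_σ_σ (h : k < j) (h' : j < i) {Y : C} (f : K.obj (disk i) ⟶ Y) :
    K.map (σ h) ≫ K.map (σ h') ≫ f = K.map (σ (h.trans h')) ≫ f := by
  rw [← Category.assoc, ← K.map_comp, σ_σ]

theorem map_σ_τ (h : k < j) (h' : j < i) {Y : C} (f : K.obj (disk i) ⟶ Y) :
    K.map (σ h) ≫ K.map (τ h') ≫ f = K.map (σ (h.trans h')) ≫ f := by
  rw [← Category.assoc, ← K.map_comp, σ_τ]

theorem map_τ_σ (h : k < j) (h' : j < i) {Y : C} (f : K.obj (disk i) ⟶ Y) :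
    K.map (τ h) ≫ K.map (σ h') ≫ f = K.map (τ (h.trans h')) ≫ f := by
  rw [← Category.assoc, ← K.map_comp, τ_σ]

theorem map_τ_τ (h : k < j) (h' : j < i) {Y : C} (f : K.obj (disk i) ⟶ Y) :
    K.map (τ h) ≫ K.map (τ h') ≫ f = K.map (τ (h.trans h')) ≫ f := by
  rw [← Category.assoc, ← K.map_comp, τ_τ]

theorem map_ε_glue (T : Table) (l : Fin T.n) :
    K.map (σ (T.lt_left l)) ≫ K.map (ε T l.castSucc) =
      K.map (τ (T.lt_right l)) ≫ K.map (ε T l.succ) := by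
  rw [← K.map_comp, ε_glue, K.map_comp]

theorem double_glue (h : j < i) :
    K.map (σ h) ≫ K.map (ε (.double h) 0) = K.map (τ h) ≫ K.map (ε (.double h) 1) :=
  map_ε_glue K (.double h) 0

theorem triple_glue₀₁ (h : j < i) :
    K.map (σ h) ≫ K.map (ε (.triple h) 0) = K.map (τ h) ≫ K.map (ε (.triple h) 1) :=
  map_ε_glue K (.triple h) 0

theorem triple_glue₁₂ (h : j < i) :
    K.map (σ h) ≫ K.map (ε (.triple h) 1) = K.map (τ h) ≫ K.map (ε (.triple h) 2) :=
  map_ε_glue K (.triple h) 1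

theorem quadruple_glue₀₁ (hkj : k < j) (hji : j < i) :
    K.map (σ hji) ≫ K.map (ε (.quadruple hkj hji) 0) = K.map (τ hji) ≫ K.map (ε (.quadruple hkj hji) 1) :=
  map_ε_glue K (.quadruple hkj hji) 0

theorem quadruple_glue₁₂ (hkj : k < j) (hji : j < i) :
    K.map (σ (hkj.trans hji)) ≫ K.map (ε (.quadruple hkj hji) 1) = K.map (τ (hkj.trans hji)) ≫ K.map (ε (.quadruple hkj hji) 2) :=
  map_ε_glue K (.quadruple hkj hji) 1

theorem quadruple_glue₂₃ (hkj : k < j) (hji : j < i) :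
    K.map (σ hji) ≫ K.map (ε (.quadruple hkj hji) 2) = K.map (τ hji) ≫ K.map (ε (.quadruple hkj hji) 3) :=
  map_ε_glue K (.quadruple hkj hji) 2

theorem quadruple_glue₀₂ (hkj : k < j) (hji : j < i) :
    K.map (σ (hkj.trans hji)) ≫ K.map (ε (.quadruple hkj hji) 0) =
      K.map (τ (hkj.trans hji)) ≫ K.map (ε (.quadruple hkj hji) 2) := by
  rw [← map_σ_σ K hkj hji, quadruple_glue₀₁, map_σ_τ, quadruple_glue₁₂]

theorem quadruple_glue₁₃ (hkj : k < j) (hji : j < i) :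
    K.map (σ (hkj.trans hji)) ≫ K.map (ε (.quadruple hkj hji) 1) =
      K.map (τ (hkj.trans hji)) ≫ K.map (ε (.quadruple hkj hji) 3) := by
  rw [quadruple_glue₁₂, ← map_τ_σ K hkj hji, quadruple_glue₂₃, map_τ_τ]

end Relations
end Extensions

section GroupoidalExtensions

variable {C : Type u} [Category.{v} C] {K : Theta0 ⥤ C}

/-- The structure of a precategorical globular extension. -/
structure Precategorical (hK : IsGlobularExtension K) where
  nabla : ∀ {j i : ℕ} (h : j < i), K.obj (disk i) ⟶ K.obj (Table.double h)
  kappa : ∀ i : ℕ, K.obj (disk (i + 1)) ⟶ K.obj (disk i)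
  σ_nabla_self : ∀ i : ℕ,
    K.map (σ i.lt_succ_self) ≫ nabla i.lt_succ_self =
      K.map (σ i.lt_succ_self) ≫ K.map (ε (.double i.lt_succ_self) 1)
  τ_nabla_self : ∀ i : ℕ,
    K.map (τ i.lt_succ_self) ≫ nabla i.lt_succ_self =
      K.map (τ i.lt_succ_self) ≫ K.map (ε (.double i.lt_succ_self) 0)
  σ_nabla_lt : ∀ {j i : ℕ} (h : j < i),
    K.map (σ i.lt_succ_self) ≫ nabla (h.trans i.lt_succ_self) =
      nabla h ≫ hK.pair h
        (K.map (σ i.lt_succ_self) ≫ K.map (ε (.double (h.trans i.lt_succ_self)) 0))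
        (K.map (σ i.lt_succ_self) ≫ K.map (ε (.double (h.trans i.lt_succ_self)) 1))
        (by rw [map_σ_σ, map_τ_σ]; exact double_glue K _)
  τ_nabla_lt : ∀ {j i : ℕ} (h : j < i),
    K.map (τ i.lt_succ_self) ≫ nabla (h.trans i.lt_succ_self) =
      nabla h ≫ hK.pair h
        (K.map (τ i.lt_succ_self) ≫ K.map (ε (.double (h.trans i.lt_succ_self)) 0))
        (K.map (τ i.lt_succ_self) ≫ K.map (ε (.double (h.trans i.lt_succ_self)) 1))
        (by rw [map_σ_τ, map_τ_τ]; exact double_glue K _)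
  σ_kappa : ∀ i : ℕ, K.map (σ i.lt_succ_self) ≫ kappa i = 𝟙 _
  τ_kappa : ∀ i : ℕ, K.map (τ i.lt_succ_self) ≫ kappa i = 𝟙 _

namespace Precategorical

variable {hK : IsGlobularExtension K} (P : Precategorical hK)

/-- The iterated unit `κ^i_j : D_i ⟶ D_j`. -/
def kappas {j i : ℕ} (h : j ≤ i) : K.obj (disk i) ⟶ K.obj (disk j) :=
  Nat.leRecOn (C := fun n => K.obj (disk n) ⟶ K.obj (disk j)) h (fun {n} f => P.kappa n ≫ f) (𝟙 _)

theorem kappas_self {j : ℕ} : P.kappas (le_refl j) = 𝟙 _ := Nat.leRecOn_self _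

theorem kappas_succ {j i : ℕ} (h : j ≤ i) :
    P.kappas (h.trans i.le_succ) = P.kappa i ≫ P.kappas h := Nat.leRecOn_succ h _

section

variable {k j i : ℕ} {Y : C}

theorem nabla_pair_congr (h : j < i) {f f' g g' : K.obj (disk i) ⟶ Y} (hf : f = f') (hg : g = g')
    (w : K.map (σ h) ≫ f = K.map (τ h) ≫ g) :
    P.nabla h ≫ hK.pair h f g w = P.nabla h ≫ hK.pair h f' g' (by rw [← hf, ← hg, w]) := by
  subst hf hg; rfl

theorem σ_nabla_pair_succ (h : j < i) (f g : K.obj (disk (i + 1)) ⟶ Y)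
    (w : K.map (σ (h.trans i.lt_succ_self)) ≫ f = K.map (τ (h.trans i.lt_succ_self)) ≫ g) :
    K.map (σ i.lt_succ_self) ≫ P.nabla (h.trans i.lt_succ_self) ≫ hK.pair _ f g w =
      P.nabla h ≫ hK.pair h (K.map (σ i.lt_succ_self) ≫ f) (K.map (σ i.lt_succ_self) ≫ g)
        (by rw [map_σ_σ, map_τ_σ, w]) := by
  rw [← Category.assoc, P.σ_nabla_lt, Category.assoc, hK.pair_comp]
  exact P.nabla_pair_congr h (by rw [Category.assoc, hK.fst_pair])
    (by rw [Category.assoc, hK.snd_pair]) _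

theorem τ_nabla_pair_succ (h : j < i) (f g : K.obj (disk (i + 1)) ⟶ Y)
    (w : K.map (σ (h.trans i.lt_succ_self)) ≫ f = K.map (τ (h.trans i.lt_succ_self)) ≫ g) :
    K.map (τ i.lt_succ_self) ≫ P.nabla (h.trans i.lt_succ_self) ≫ hK.pair _ f g w =
      P.nabla h ≫ hK.pair h (K.map (τ i.lt_succ_self) ≫ f) (K.map (τ i.lt_succ_self) ≫ g)
        (by rw [map_σ_τ, map_τ_τ, w]) := by
  rw [← Category.assoc, P.τ_nabla_lt, Category.assoc, hK.pair_comp]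
  exact P.nabla_pair_congr h (by rw [Category.assoc, hK.fst_pair])
    (by rw [Category.assoc, hK.snd_pair]) _

theorem σ_nabla_pair (h : j < i) (f g : K.obj (disk i) ⟶ Y)
    (w : K.map (σ h) ≫ f = K.map (τ h) ≫ g) :
    K.map (σ h) ≫ P.nabla h ≫ hK.pair h f g w = K.map (σ h) ≫ g := by
  induction i with
  | zero => omega
  | succ i ih =>
    rcases Nat.lt_succ_iff_lt_or_eq.1 h with h' | rfl
    · rw [← map_σ_σ K h' i.lt_succ_self, P.σ_nabla_pair_succ h', ih, map_σ_σ]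
    · rw [← Category.assoc, P.σ_nabla_self, Category.assoc, hK.snd_pair]

theorem τ_nabla_pair (h : j < i) (f g : K.obj (disk i) ⟶ Y)
    (w : K.map (σ h) ≫ f = K.map (τ h) ≫ g) :
    K.map (τ h) ≫ P.nabla h ≫ hK.pair h f g w = K.map (τ h) ≫ f := by
  induction i with
  | zero => omega
  | succ i ih =>
    rcases Nat.lt_succ_iff_lt_or_eq.1 h with h' | rfl
    · rw [← map_τ_τ K h' i.lt_succ_self, P.τ_nabla_pair_succ h', ih, map_τ_τ]
    · rw [← Category.assoc, P.τ_nabla_self, Category.assoc, hK.fst_pair]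

theorem σ_nabla_pair_low (hkj : k < j) (h : j < i) (f g : K.obj (disk i) ⟶ Y)
    (w : K.map (σ h) ≫ f = K.map (τ h) ≫ g) :
    K.map (σ (hkj.trans h)) ≫ P.nabla h ≫ hK.pair h f g w = K.map (σ (hkj.trans h)) ≫ f := by
  rw [← map_σ_τ K hkj h, P.τ_nabla_pair, map_σ_τ]

theorem τ_nabla_pair_low (hkj : k < j) (h : j < i) (f g : K.obj (disk i) ⟶ Y)
    (w : K.map (σ h) ≫ f = K.map (τ h) ≫ g) :
    K.map (τ (hkj.trans h)) ≫ P.nabla h ≫ hK.pair h f g w = K.map (τ (hkj.trans h)) ≫ f := by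
  rw [← map_τ_τ K hkj h, P.τ_nabla_pair, map_τ_τ]

theorem σ_nabla_pair_high (hkj : k < j) (h : j < i) (f g : K.obj (disk i) ⟶ Y)
    (w : K.map (σ (hkj.trans h)) ≫ f = K.map (τ (hkj.trans h)) ≫ g) :
    K.map (σ h) ≫ P.nabla (hkj.trans h) ≫ hK.pair _ f g w =
      P.nabla hkj ≫ hK.pair hkj (K.map (σ h) ≫ f) (K.map (σ h) ≫ g)
        (by rw [map_σ_σ, map_τ_σ, w]) := by
  induction i with
  | zero => omega
  | succ i ih =>
    rcases Nat.lt_succ_iff_lt_or_eq.1 h with h' | rfl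
    · rw [← map_σ_σ K h' i.lt_succ_self, P.σ_nabla_pair_succ (hkj.trans h'), ih h']
      exact P.nabla_pair_congr hkj (map_σ_σ _ _ _ _) (map_σ_σ _ _ _ _) _
    · exact P.σ_nabla_pair_succ hkj f g w

theorem τ_nabla_pair_high (hkj : k < j) (h : j < i) (f g : K.obj (disk i) ⟶ Y)
    (w : K.map (σ (hkj.trans h)) ≫ f = K.map (τ (hkj.trans h)) ≫ g) :
    K.map (τ h) ≫ P.nabla (hkj.trans h) ≫ hK.pair _ f g w =
      P.nabla hkj ≫ hK.pair hkj (K.map (τ h) ≫ f) (K.map (τ h) ≫ g)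
        (by rw [map_σ_τ, map_τ_τ, w]) := by
  induction i with
  | zero => omega
  | succ i ih =>
    rcases Nat.lt_succ_iff_lt_or_eq.1 h with h' | rfl
    · rw [← map_τ_τ K h' i.lt_succ_self, P.τ_nabla_pair_succ (hkj.trans h'), ih h']
      exact P.nabla_pair_congr hkj (map_τ_τ _ _ _ _) (map_τ_τ _ _ _ _) _
    · exact P.τ_nabla_pair_succ hkj f g w

theorem σ_kappas (h : j < i) : K.map (σ h) ≫ P.kappas h.le = 𝟙 _ := by
  induction i with
  | zero => omega
  | succ i ih =>
    rcases Nat.lt_succ_iff_lt_or_eq.1 h with h' | rfl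
    · rw [P.kappas_succ h'.le, ← map_σ_σ K h' i.lt_succ_self, ← Category.assoc (K.map (σ _)) (P.kappa i),
        P.σ_kappa, Category.id_comp, ih]
    · rw [P.kappas_succ le_rfl, P.kappas_self, Category.comp_id, P.σ_kappa]

theorem τ_kappas (h : j < i) : K.map (τ h) ≫ P.kappas h.le = 𝟙 _ := by
  induction i with
  | zero => omega
  | succ i ih =>
    rcases Nat.lt_succ_iff_lt_or_eq.1 h with h' | rfl
    · rw [P.kappas_succ h'.le, ← map_τ_τ K h' i.lt_succ_self, ← Category.assoc (K.map (τ _)) (P.kappa i),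
        P.τ_kappa, Category.id_comp, ih]
    · rw [P.kappas_succ le_rfl, P.kappas_self, Category.comp_id, P.τ_kappa]

end

/-- The axioms of categorical globular extensions.

* `ass`: `(id ⨿ ∇) ∇ = (∇ ⨿ id) ∇` as morphisms to `D_i ⨿_{D_j} D_i ⨿_{D_j} D_i`.
* `exc`: the two composites to `D_i ⨿_{D_j} D_i ⨿_{D_k} D_i ⨿_{D_j} D_i`, which is canonically
  isomorphic both to `(D_i ⨿_{D_j} D_i) ⨿_{D_k} (D_i ⨿_{D_j} D_i)` and to
  `(D_i ⨿_{D_k} D_i) ⨿_{D_j ⨿_{D_k} D_j} (D_i ⨿_{D_k} D_i)`, are equal.  If `ε_0, …, ε_3` denote the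
  canonical morphisms, the first one is `((ε_0, ε_1) ∇_j, (ε_2, ε_3) ∇_j) ∇_k` and the second one
  is `((ε_0, ε_2) ∇_k, (ε_1, ε_3) ∇_k) ∇_j`.
* `lun`, `run`: the unit laws, under the identifications `(τ, id) : D_j ⨿_{D_j} D_i ≅ D_i` and
  `(id, σ) : D_i ⨿_{D_j} D_j ≅ D_i`.
* `fun_kappa`: `(κ ⨿ κ) ∇ = ∇ κ`. -/
structure IsCategorical : Prop where
  ass : ∀ {j i : ℕ} (h : j < i),
    P.nabla h ≫ hK.pair h (K.map (ε (.triple h) 0))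
        (P.nabla h ≫ hK.pair h (K.map (ε (.triple h) 1)) (K.map (ε (.triple h) 2))
          (triple_glue₁₂ K h))
        (by rw [P.τ_nabla_pair]; exact triple_glue₀₁ K h) =
      P.nabla h ≫ hK.pair h
        (P.nabla h ≫ hK.pair h (K.map (ε (.triple h) 0)) (K.map (ε (.triple h) 1))
          (triple_glue₀₁ K h))
        (K.map (ε (.triple h) 2))
        (by rw [P.σ_nabla_pair]; exact triple_glue₁₂ K h)
  exc : ∀ {k j i : ℕ} (hkj : k < j) (hji : j < i),
    P.nabla (hkj.trans hji) ≫ hK.pair (hkj.trans hji)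
        (P.nabla hji ≫ hK.pair hji (K.map (ε (.quadruple hkj hji) 0))
          (K.map (ε (.quadruple hkj hji) 1)) (quadruple_glue₀₁ K hkj hji))
        (P.nabla hji ≫ hK.pair hji (K.map (ε (.quadruple hkj hji) 2))
          (K.map (ε (.quadruple hkj hji) 3)) (quadruple_glue₂₃ K hkj hji))
        (by
          rw [P.τ_nabla_pair_low hkj, ← map_σ_σ K hkj hji, P.σ_nabla_pair, map_σ_σ]
          exact quadruple_glue₁₂ K hkj hji) =
      P.nabla hji ≫ hK.pair hji
        (P.nabla (hkj.trans hji) ≫ hK.pair (hkj.trans hji) (K.map (ε (.quadruple hkj hji) 0))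
          (K.map (ε (.quadruple hkj hji) 2)) (quadruple_glue₀₂ K hkj hji))
        (P.nabla (hkj.trans hji) ≫ hK.pair (hkj.trans hji) (K.map (ε (.quadruple hkj hji) 1))
          (K.map (ε (.quadruple hkj hji) 3)) (quadruple_glue₁₃ K hkj hji))
        (by
          rw [P.σ_nabla_pair_high hkj, P.τ_nabla_pair_high hkj]
          exact P.nabla_pair_congr hkj (quadruple_glue₀₁ K hkj hji)
            (quadruple_glue₂₃ K hkj hji) _)
  lun : ∀ {j i : ℕ} (h : j < i),
    P.nabla h ≫ hK.pair h (P.kappas h.le ≫ K.map (τ h)) (𝟙 _)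
      (by rw [← Category.assoc, P.σ_kappas, Category.id_comp, Category.comp_id]) = 𝟙 _
  run : ∀ {j i : ℕ} (h : j < i),
    P.nabla h ≫ hK.pair h (𝟙 _) (P.kappas h.le ≫ K.map (σ h))
      (by rw [← Category.assoc, P.τ_kappas, Category.id_comp, Category.comp_id]) = 𝟙 _
  fun_kappa : ∀ {j i : ℕ} (h : j < i),
    P.nabla (h.trans i.lt_succ_self) ≫ hK.pair (h.trans i.lt_succ_self)
        (P.kappa i ≫ K.map (ε (.double h) 0)) (P.kappa i ≫ K.map (ε (.double h) 1))
        (by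
          rw [← map_σ_σ K h i.lt_succ_self, ← Category.assoc (K.map (σ i.lt_succ_self)), P.σ_kappa,
            Category.id_comp, ← map_τ_τ K h i.lt_succ_self,
            ← Category.assoc (K.map (τ i.lt_succ_self)), P.τ_kappa, Category.id_comp]
          exact double_glue K h) =
      P.kappa i ≫ P.nabla h

end Precategorical

/-- The structure of a pregroupoidal globular extension. -/
structure Pregroupoidal (hK : IsGlobularExtension K) extends Precategorical hK where
  omega : ∀ {j i : ℕ}, j < i → (K.obj (disk i) ⟶ K.obj (disk i))
  σ_omega_self : ∀ i : ℕ,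
    K.map (σ i.lt_succ_self) ≫ omega i.lt_succ_self = K.map (τ i.lt_succ_self)
  τ_omega_self : ∀ i : ℕ,
    K.map (τ i.lt_succ_self) ≫ omega i.lt_succ_self = K.map (σ i.lt_succ_self)
  σ_omega_lt : ∀ {j i : ℕ} (h : j < i),
    K.map (σ i.lt_succ_self) ≫ omega (h.trans i.lt_succ_self) =
      omega h ≫ K.map (σ i.lt_succ_self)
  τ_omega_lt : ∀ {j i : ℕ} (h : j < i),
    K.map (τ i.lt_succ_self) ≫ omega (h.trans i.lt_succ_self) =
      omega h ≫ K.map (τ i.lt_succ_self)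

namespace Pregroupoidal

variable {hK : IsGlobularExtension K} (P : Pregroupoidal hK) {j i : ℕ}

theorem σ_omega (h : j < i) : K.map (σ h) ≫ P.omega h = K.map (τ h) := by
  induction i with
  | zero => omega
  | succ i ih =>
    rcases Nat.lt_succ_iff_lt_or_eq.1 h with h' | rfl
    · rw [← map_σ_σ K h' i.lt_succ_self, P.σ_omega_lt h', ← Category.assoc, ih, ← K.map_comp, τ_σ]
    · exact P.σ_omega_self _

theorem τ_omega (h : j < i) : K.map (τ h) ≫ P.omega h = K.map (σ h) := by
  induction i with
  | zero => omega
  | succ i ih =>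
    rcases Nat.lt_succ_iff_lt_or_eq.1 h with h' | rfl
    · rw [← map_τ_τ K h' i.lt_succ_self, P.τ_omega_lt h', ← Category.assoc, ih, ← K.map_comp, σ_τ]
    · exact P.τ_omega_self _

/-- The axioms of groupoidal globular extensions. -/
structure IsGroupoidal : Prop extends P.toPrecategorical.IsCategorical where
  linv : ∀ {j i : ℕ} (h : j < i),
    P.nabla h ≫ hK.pair h (P.omega h) (𝟙 _) (by rw [P.σ_omega, Category.comp_id]) =
      P.kappas h.le ≫ K.map (σ h)
  rinv : ∀ {j i : ℕ} (h : j < i),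
    P.nabla h ≫ hK.pair h (𝟙 _) (P.omega h) (by rw [P.τ_omega, Category.comp_id]) =
      P.kappas h.le ≫ K.map (τ h)

end Pregroupoidal

/-- The structure of a groupoidal globular extension on a category under `Θ₀`. -/
structure GroupoidalExtension (K : Theta0 ⥤ C) where
  isGlobular : IsGlobularExtension K
  str : Pregroupoidal isGlobular
  isGroupoidal : str.IsGroupoidal

end GroupoidalExtensions

/-! ### Models and their underlying strict ∞-groupoids -/

section Models

variable {C : Type u} [Category.{v} C] (K : Theta0 ⥤ C)

/-- The shape of the diagram dual to the one defining globular sums. -/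
def Table.coshape (T : Table) : MulticospanShape where
  L := Fin (T.n + 1)
  R := Fin T.n
  fst := Fin.castSucc
  snd := Fin.succ

/-- The diagram of sets whose limit is the globular product attached to `T`, for a presheaf `X`. -/
noncomputable def presheafDiagram (X : Cᵒᵖ ⥤ Type) (T : Table) :
    MulticospanIndex T.coshape Type where
  left k := X.obj (op (K.obj (disk (T.top k))))
  right l := X.obj (op (K.obj (disk (T.bot l))))
  fst l := X.map (K.map (σ (T.lt_left l))).op
  snd l := X.map (K.map (τ (T.lt_right l))).op

/-- The image by a presheaf `X` of the cocone exhibiting `K S_T` as a globular sum. -/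
noncomputable def presheafFork (X : Cᵒᵖ ⥤ Type) (T : Table) : Multifork (presheafDiagram K X T) :=
  Multifork.ofι _ (X.obj (op (K.obj T))) (fun k => X.map (K.map (ε T k)).op) fun l => by
    have := congrArg (fun f => X.map f.op) (map_ε_glue K T l)
    simp only [op_comp, X.map_comp] at this
    exact this

/-- Models of (or globular presheaves on) a globular extension: presheaves sending globular sums to
globular products. -/
def IsModel : ObjectProperty (Cᵒᵖ ⥤ Type) := fun X =>
  ∀ T : Table, Nonempty (IsLimit (presheafFork K X T))

/-- The category `Mod(C)` of models of a globular extension `C`. -/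
abbrev Mod := (IsModel K).FullSubcategory

namespace IsModel

variable {K} {X : Cᵒᵖ ⥤ Type} (hX : IsModel K X)

theorem ext {K : Theta0 ⥤ C} {X : Cᵒᵖ ⥤ Type} (hX : IsModel K X) (T : Table) {z z' : X.obj (op (K.obj T))}
    (h : ∀ k, X.map (K.map (ε T k)).op z = X.map (K.map (ε T k)).op z') : z = z' :=
  ((Multifork.isLimit_types_iff (presheafFork K X T)).1 (hX T)).1
    (MulticospanIndex.sections.ext (funext h))

/-- The element of `X(S_T)` determined by a compatible family of elements of the `X(D_{i_k})`. -/
noncomputable def glue (T : Table) (u : ∀ k, X.obj (op (K.obj (disk (T.top k)))))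
    (w : ∀ l : Fin T.n, X.map (K.map (σ (T.lt_left l))).op (u l.castSucc) =
      X.map (K.map (τ (T.lt_right l))).op (u l.succ)) : X.obj (op (K.obj T)) :=
  (((Multifork.isLimit_types_iff (presheafFork K X T)).1 (hX T)).2 ⟨u, w⟩).choose

theorem map_ε_glue (T : Table) (u : ∀ k, X.obj (op (K.obj (disk (T.top k)))))
    (w : ∀ l : Fin T.n, X.map (K.map (σ (T.lt_left l))).op (u l.castSucc) =
      X.map (K.map (τ (T.lt_right l))).op (u l.succ)) (k : Fin (T.n + 1)) :
    X.map (K.map (ε T k)).op (hX.glue T u w) = u k :=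
  congrFun (congrArg MulticospanIndex.sections.val
    (((Multifork.isLimit_types_iff (presheafFork K X T)).1 (hX T)).2 ⟨u, w⟩).choose_spec) k

/-- The element of `X(D_i ⨿_{D_j} D_i)` corresponding to a pair in `X_i ×_{X_j} X_i`. -/
noncomputable def pair {j i : ℕ} (h : j < i) (u v : X.obj (op (K.obj (disk i))))
    (w : X.map (K.map (σ h)).op u = X.map (K.map (τ h)).op v) :
    X.obj (op (K.obj (Table.double h))) :=
  hX.glue (Table.double h) ![u, v] fun l => by
    obtain rfl : l = 0 := Subsingleton.elim (α := Fin 1) _ _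
    exact w

theorem fst_pair {j i : ℕ} (h : j < i) (u v : X.obj (op (K.obj (disk i))))
    (w : X.map (K.map (σ h)).op u = X.map (K.map (τ h)).op v) :
    X.map (K.map (ε (.double h) 0)).op (hX.pair h u v w) = u :=
  hX.map_ε_glue (Table.double h) ![u, v] _ 0

theorem snd_pair {j i : ℕ} (h : j < i) (u v : X.obj (op (K.obj (disk i))))
    (w : X.map (K.map (σ h)).op u = X.map (K.map (τ h)).op v) :
    X.map (K.map (ε (.double h) 1)).op (hX.pair h u v w) = v :=
  hX.map_ε_glue (Table.double h) ![u, v] _ 1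

theorem eq_pair {j i : ℕ} (h : j < i) (u v : X.obj (op (K.obj (disk i))))
    (w : X.map (K.map (σ h)).op u = X.map (K.map (τ h)).op v)
    (z : X.obj (op (K.obj (Table.double h))))
    (h₀ : X.map (K.map (ε (.double h) 0)).op z = u)
    (h₁ : X.map (K.map (ε (.double h) 1)).op z = v) : hX.pair h u v w = z :=
  hX.ext (Table.double h) (Fin.forall_fin_two.2
    ⟨(hX.fst_pair h u v w).trans h₀.symm, (hX.snd_pair h u v w).trans h₁.symm⟩)

theorem map_comp_op (X : Cᵒᵖ ⥤ Type) {A B D : C} (f : A ⟶ B) (g : B ⟶ D) (z : X.obj (op D)) :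
    X.map (f ≫ g).op z = X.map f.op (X.map g.op z) :=
  X.map_comp_apply g.op f.op z

section

variable {hK : IsGlobularExtension K} (P : Precategorical hK)

/-- The composition `X(∇) : X_i ×_{X_j} X_i → X_i`. -/
noncomputable def comp {j i : ℕ} (h : j < i) (u v : X.obj (op (K.obj (disk i))))
    (w : X.map (K.map (σ h)).op u = X.map (K.map (τ h)).op v) : X.obj (op (K.obj (disk i))) :=
  X.map (P.nabla h).op (hX.pair h u v w)

theorem comp_eq {j i : ℕ} (h : j < i) {u v : X.obj (op (K.obj (disk i)))}
    (w : X.map (K.map (σ h)).op u = X.map (K.map (τ h)).op v)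
    {Y : C} {f g : K.obj (disk i) ⟶ Y} (w' : K.map (σ h) ≫ f = K.map (τ h) ≫ g)
    (z : X.obj (op Y)) (hu : u = X.map f.op z) (hv : v = X.map g.op z) :
    hX.comp P h u v w = X.map (P.nabla h ≫ hK.pair h f g w').op z := by
  rw [map_comp_op]
  refine congrArg _ (hX.eq_pair h u v w _ ?_ ?_)
  · rw [← map_comp_op, hK.fst_pair, hu]
  · rw [← map_comp_op, hK.snd_pair, hv]

theorem exists_triple {K : Theta0 ⥤ C} {X : Cᵒᵖ ⥤ Type} (hX : IsModel K X) {j i : ℕ} (h : j < i) (u v w : X.obj (op (K.obj (disk i))))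
    (huv : X.map (K.map (σ h)).op u = X.map (K.map (τ h)).op v)
    (hvw : X.map (K.map (σ h)).op v = X.map (K.map (τ h)).op w) :
    ∃ z : X.obj (op (K.obj (Table.triple h))), u = X.map (K.map (ε (.triple h) 0)).op z ∧
      v = X.map (K.map (ε (.triple h) 1)).op z ∧ w = X.map (K.map (ε (.triple h) 2)).op z := by
  have key : ∀ l : Fin 2, X.map (K.map (σ h)).op (![u, v, w] l.castSucc) =
      X.map (K.map (τ h)).op (![u, v, w] l.succ) := Fin.forall_fin_two.2 ⟨huv, hvw⟩
  exact ⟨hX.glue (.triple h) ![u, v, w] key, (hX.map_ε_glue (.triple h) ![u, v, w] key 0).symm,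
    (hX.map_ε_glue (.triple h) ![u, v, w] key 1).symm,
    (hX.map_ε_glue (.triple h) ![u, v, w] key 2).symm⟩

theorem exists_quadruple {K : Theta0 ⥤ C} {X : Cᵒᵖ ⥤ Type} (hX : IsModel K X) {k j i : ℕ} (hkj : k < j) (hji : j < i)
    (u u' v v' : X.obj (op (K.obj (disk i))))
    (hu : X.map (K.map (σ hji)).op u = X.map (K.map (τ hji)).op u')
    (huv : X.map (K.map (σ (hkj.trans hji))).op u' = X.map (K.map (τ (hkj.trans hji))).op v)
    (hv : X.map (K.map (σ hji)).op v = X.map (K.map (τ hji)).op v') :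
    ∃ z : X.obj (op (K.obj (Table.quadruple hkj hji))),
      u = X.map (K.map (ε (.quadruple hkj hji) 0)).op z ∧
      u' = X.map (K.map (ε (.quadruple hkj hji) 1)).op z ∧
      v = X.map (K.map (ε (.quadruple hkj hji) 2)).op z ∧
      v' = X.map (K.map (ε (.quadruple hkj hji) 3)).op z := by
  have key : ∀ l : Fin 3,
      X.map (K.map (σ ((Table.quadruple hkj hji).lt_left l))).op (![u, u', v, v'] l.castSucc) =
      X.map (K.map (τ ((Table.quadruple hkj hji).lt_right l))).op (![u, u', v, v'] l.succ) := by
    intro l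
    match l with
    | 0 => exact hu
    | 1 => exact huv
    | 2 => exact hv
  exact ⟨hX.glue (.quadruple hkj hji) ![u, u', v, v'] key,
    (hX.map_ε_glue (.quadruple hkj hji) ![u, u', v, v'] key 0).symm,
    (hX.map_ε_glue (.quadruple hkj hji) ![u, u', v, v'] key 1).symm,
    (hX.map_ε_glue (.quadruple hkj hji) ![u, u', v, v'] key 2).symm,
    (hX.map_ε_glue (.quadruple hkj hji) ![u, u', v, v'] key 3).symm⟩

end

section

variable {hK : IsGlobularExtension K} {P : Precategorical hK}

theorem map_id_op (X : Cᵒᵖ ⥤ Type) {A : C} (z : X.obj (op A)) : z = X.map (𝟙 A).op z :=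
  (X.map_id_apply (X := op A) z).symm

theorem src_comp_self (i : ℕ) (u v : X.obj (op (K.obj (disk (i + 1)))))
    (w : X.map (K.map (σ i.lt_succ_self)).op u = X.map (K.map (τ i.lt_succ_self)).op v) :
    X.map (K.map (σ i.lt_succ_self)).op (hX.comp P i.lt_succ_self u v w) =
      X.map (K.map (σ i.lt_succ_self)).op v := by
  rw [comp, ← map_comp_op, P.σ_nabla_self, map_comp_op, hX.snd_pair]

theorem tgt_comp_self (i : ℕ) (u v : X.obj (op (K.obj (disk (i + 1)))))
    (w : X.map (K.map (σ i.lt_succ_self)).op u = X.map (K.map (τ i.lt_succ_self)).op v) :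
    X.map (K.map (τ i.lt_succ_self)).op (hX.comp P i.lt_succ_self u v w) =
      X.map (K.map (τ i.lt_succ_self)).op u := by
  rw [comp, ← map_comp_op, P.τ_nabla_self, map_comp_op, hX.fst_pair]

theorem src_comp_lt {j i : ℕ} (h : j < i) (u v : X.obj (op (K.obj (disk (i + 1)))))
    (w : X.map (K.map (σ (h.trans i.lt_succ_self))).op u =
      X.map (K.map (τ (h.trans i.lt_succ_self))).op v)
    (w' : X.map (K.map (σ h)).op (X.map (K.map (σ i.lt_succ_self)).op u) =
      X.map (K.map (τ h)).op (X.map (K.map (σ i.lt_succ_self)).op v)) :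
    X.map (K.map (σ i.lt_succ_self)).op (hX.comp P (h.trans i.lt_succ_self) u v w) =
      hX.comp P h (X.map (K.map (σ i.lt_succ_self)).op u)
        (X.map (K.map (σ i.lt_succ_self)).op v) w' := by
  rw [comp, ← map_comp_op, P.σ_nabla_lt]
  refine (hX.comp_eq P h _ _ _ ?_ ?_).symm
  · rw [map_comp_op, hX.fst_pair]
  · rw [map_comp_op, hX.snd_pair]

theorem tgt_comp_lt {j i : ℕ} (h : j < i) (u v : X.obj (op (K.obj (disk (i + 1)))))
    (w : X.map (K.map (σ (h.trans i.lt_succ_self))).op u =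
      X.map (K.map (τ (h.trans i.lt_succ_self))).op v)
    (w' : X.map (K.map (σ h)).op (X.map (K.map (τ i.lt_succ_self)).op u) =
      X.map (K.map (τ h)).op (X.map (K.map (τ i.lt_succ_self)).op v)) :
    X.map (K.map (τ i.lt_succ_self)).op (hX.comp P (h.trans i.lt_succ_self) u v w) =
      hX.comp P h (X.map (K.map (τ i.lt_succ_self)).op u)
        (X.map (K.map (τ i.lt_succ_self)).op v) w' := by
  rw [comp, ← map_comp_op, P.τ_nabla_lt]
  refine (hX.comp_eq P h _ _ _ ?_ ?_).symm
  · rw [map_comp_op, hX.fst_pair]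
  · rw [map_comp_op, hX.snd_pair]

theorem map_eq_of_eq_id {A B : C} {f : A ⟶ B} {g : B ⟶ A} (h : f ≫ g = 𝟙 A)
    (X : Cᵒᵖ ⥤ Type) (z : X.obj (op A)) : X.map f.op (X.map g.op z) = z := by
  rw [← map_comp_op, h, ← map_id_op]

theorem map_map_eq {A B B' D : C} {f : A ⟶ B} {g : B ⟶ D} {f' : A ⟶ B'} {g' : B' ⟶ D}
    (h : f ≫ g = f' ≫ g') (X : Cᵒᵖ ⥤ Type) (z : X.obj (op D)) :
    X.map f.op (X.map g.op z) = X.map f'.op (X.map g'.op z) := by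
  rw [← map_comp_op, h, map_comp_op]

theorem map_map_eq' {A B D : C} {f : A ⟶ B} {g : B ⟶ D} {f' : A ⟶ D}
    (h : f ≫ g = f') (X : Cᵒᵖ ⥤ Type) (z : X.obj (op D)) :
    X.map f.op (X.map g.op z) = X.map f'.op z := by
  rw [← map_comp_op, h]

theorem fun_unit (hP : P.IsCategorical) {j i : ℕ} (h : j < i) (u v : X.obj (op (K.obj (disk i))))
    (w : X.map (K.map (σ h)).op u = X.map (K.map (τ h)).op v)
    (w' : X.map (K.map (σ (h.trans i.lt_succ_self))).op (X.map (P.kappa i).op u) =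
      X.map (K.map (τ (h.trans i.lt_succ_self))).op (X.map (P.kappa i).op v)) :
    X.map (P.kappa i).op (hX.comp P h u v w) =
      hX.comp P (h.trans i.lt_succ_self) (X.map (P.kappa i).op u) (X.map (P.kappa i).op v) w' := by
  rw [comp, ← map_comp_op, ← hP.fun_kappa h]
  refine (hX.comp_eq P _ _ _ _ ?_ ?_).symm
  · rw [map_comp_op, hX.fst_pair]
  · rw [map_comp_op, hX.snd_pair]

end

/-- The globular set obtained by restricting a presheaf on `C` to `𝔾`. -/
noncomputable abbrev globularSet (K : Theta0 ⥤ C) (X : Cᵒᵖ ⥤ Type) : GlobularSet :=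
  (ofGlobe ⋙ K).op ⋙ X

variable {hK : IsGlobularExtension K}

/-- The ∞-precategory structure on the globular set underlying a model `X`: the compositions are
the `X(∇^i_j)` and the units are the `X(κ_i)`. -/
noncomputable def precategory (P : Precategorical hK) : InfPrecategory (globularSet K X) where
  comp {j i} h u v w := hX.comp (K := K) P (j := j) (i := i) h u v w
  unit i u := X.map (P.kappa i).op u
  src_comp_self i u v w := hX.src_comp_self i u v w
  tgt_comp_self i u v w := hX.tgt_comp_self i u v w
  src_comp_lt h u v w := hX.src_comp_lt h u v w _
  tgt_comp_lt h u v w := hX.tgt_comp_lt h u v w _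
  src_unit i u := map_eq_of_eq_id (P.σ_kappa i) X u
  tgt_unit i u := map_eq_of_eq_id (P.τ_kappa i) X u

theorem precategory_units (P : Precategorical hK) {j i : ℕ} (h : j ≤ i)
    (u : (globularSet K X).cell j) :
    (hX.precategory P).units h u = X.map (P.kappas h).op u := by
  induction i, h using Nat.le_induction with
  | base =>
    refine (InfPrecategory.units_self _ u).trans ((map_id_op X u).trans ?_)
    exact congrArg (fun f => X.map f.op u) P.kappas_self.symm
  | succ i h ih =>
    refine (InfPrecategory.units_succ _ h u).trans ((congrArg _ ih).trans ?_)
    exact map_map_eq' (P.kappas_succ h).symm X u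

theorem precategory_isStrict {P : Precategorical hK} (hP : P.IsCategorical) :
    (hX.precategory P).IsStrictCategory where
  ass h u v w huv hvw := by
    obtain ⟨z, hu, hv, hw⟩ := hX.exists_triple h u v w huv hvw
    have := congrArg (fun f => X.map f.op z) (hP.ass h)
    refine Eq.trans ?_ (this.symm.trans ?_)
    · exact hX.comp_eq P h _ _ z (hX.comp_eq P h _ _ z hu hv) hw
    · exact (hX.comp_eq P h _ _ z hu (hX.comp_eq P h _ _ z hv hw)).symm
  exc hkj hji u u' v v' hu huv hv := by
    obtain ⟨z, h₀, h₁, h₂, h₃⟩ := hX.exists_quadruple hkj hji u u' v v' hu huv hv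
    have := congrArg (fun f => X.map f.op z) (hP.exc hkj hji)
    refine Eq.trans ?_ (this.trans ?_)
    · exact hX.comp_eq P _ _ _ z (hX.comp_eq P _ _ _ z h₀ h₁) (hX.comp_eq P _ _ _ z h₂ h₃)
    · exact (hX.comp_eq P _ _ _ z (hX.comp_eq P _ _ _ z h₀ h₂)
        (hX.comp_eq P _ _ _ z h₁ h₃)).symm
  lun h u := by
    have := congrArg (fun f => X.map f.op u) (hP.lun h)
    refine Eq.trans ?_ (this.trans (map_id_op X u).symm)
    exact hX.comp_eq P h _ _ u ((hX.precategory_units P h.le _).trans (map_comp_op X _ _ u).symm)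
      (map_id_op X u)
  run h u := by
    have := congrArg (fun f => X.map f.op u) (hP.run h)
    refine Eq.trans ?_ (this.trans (map_id_op X u).symm)
    exact hX.comp_eq P h _ _ u (map_id_op X u)
      ((hX.precategory_units P h.le _).trans (map_comp_op X _ _ u).symm)
  fun_unit h u v w := hX.fun_unit hP h u v w _

/-- The ∞-pregroupoid structure on the globular set underlying a model `X`: the inverses are
the `X(ω^i_j)`. -/
noncomputable def pregroupoid (P : Pregroupoidal hK) : InfPregroupoid (globularSet K X) where
  toInfPrecategory := hX.precategory P.toPrecategorical
  inv h u := X.map (P.omega h).op u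
  src_inv_self i u := map_map_eq' (P.σ_omega_self i) X u
  tgt_inv_self i u := map_map_eq' (P.τ_omega_self i) X u
  src_inv_lt h u := map_map_eq (P.σ_omega_lt h) X u
  tgt_inv_lt h u := map_map_eq (P.τ_omega_lt h) X u

theorem pregroupoid_isStrict {P : Pregroupoidal hK} (hP : P.IsGroupoidal) :
    (hX.pregroupoid P).IsStrictGroupoid where
  toIsStrictCategory := hX.precategory_isStrict hP.toIsCategorical
  linv h u := by
    have := congrArg (fun f => X.map f.op u) (hP.linv h)
    refine Eq.trans ?_ (this.trans ((map_comp_op X _ _ u).trans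
      (hX.precategory_units P.toPrecategorical h.le _).symm))
    exact hX.comp_eq P.toPrecategorical h _ _ u rfl (map_id_op X u)
  rinv h u := by
    have := congrArg (fun f => X.map f.op u) (hP.rinv h)
    refine Eq.trans ?_ (this.trans ((map_comp_op X _ _ u).trans
      (hX.precategory_units P.toPrecategorical h.le _).symm))
    exact hX.comp_eq P.toPrecategorical h _ _ u (map_id_op X u) rfl

end IsModel

variable {K}

/-- The canonical functor `Mod(C) ⥤ ∞-Grpd`, for a groupoidal globular extension `C`. -/
noncomputable def GroupoidalExtension.modToGroupoid (E : GroupoidalExtension K) :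
    Mod K ⥤ StrictInfGroupoid where
  obj X :=
    { cells := IsModel.globularSet K X.obj
      str := X.property.pregroupoid E.str
      isStrict := X.property.pregroupoid_isStrict E.isGroupoidal }
  map {X Y} f :=
    { map := Functor.whiskerLeft (ofGlobe ⋙ K).op f.hom
      map_comp := fun {j i} h u v w => by
        refine (NatTrans.naturality_apply f.hom (E.str.nabla h).op _).trans ?_
        refine congrArg _ (Y.property.eq_pair h _ _ _ _ ?_ ?_).symm
        · exact (NatTrans.naturality_apply f.hom (K.map (ε (.double h) 0)).op _).symm.trans
            (congrArg _ (X.property.fst_pair h u v w))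
        · exact (NatTrans.naturality_apply f.hom (K.map (ε (.double h) 1)).op _).symm.trans
            (congrArg _ (X.property.snd_pair h u v w))
      map_unit := fun i u => NatTrans.naturality_apply f.hom (E.str.kappa i).op u
      map_inv := fun h u => NatTrans.naturality_apply f.hom (E.str.omega h).op u }
  map_id _ := rfl
  map_comp _ _ := rfl

end Models

/-! ### The category `Θ̃`

`Θ̃` is the groupoidal globular extension freely generated by `Θ₀`.  Its objects are those of `Θ₀`.
Its morphisms are formal expressions built from the morphisms of `Θ₀` and from formal morphisms
`∇^i_j`, `κ_i` and `ω^i_j` by composition and by the universal property of globular sums, modulo the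
smallest congruence which makes it a groupoidal globular extension.  The universal property of `Θ̃`
is proved in `ThetaTilde.existsUnique_lift` below. -/

/-- Formal expressions for morphisms of `Θ̃`. -/
inductive Term : Theta0 → Theta0 → Type
  | of {S T : Theta0} (f : S ⟶ T) : Term S T
  | comp {S T U : Theta0} (f : Term S T) (g : Term T U) : Term S U
  | nabla {j i : ℕ} (h : j < i) : Term (disk i) (Table.double h)
  | kappa (i : ℕ) : Term (disk (i + 1)) (disk i)
  | omega {j i : ℕ} (h : j < i) : Term (disk i) (disk i)
  | desc (T : Table) {Y : Theta0} (f : ∀ k : Fin (T.n + 1), Term (disk (T.top k)) Y) : Term T Y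

namespace Term

/-- The formal expression `(f, g) : D_i ⨿_{D_j} D_i ⟶ Y`. -/
noncomputable def pair {j i : ℕ} (h : j < i) {Y : Theta0} (f g : Term (disk i) Y) : Term (Table.double h) Y :=
  desc (Table.double h) ![f, g]

/-- The formal expression `(f, g) ∇^i_j`. -/
noncomputable def nablaPair {j i : ℕ} (h : j < i) {Y : Theta0} (f g : Term (disk i) Y) : Term (disk i) Y :=
  (nabla h).comp (pair h f g)

/-- The formal expression `κ^i_j`. -/
noncomputable def kappas {j i : ℕ} (h : j ≤ i) : Term (disk i) (disk j) :=
  Nat.leRecOn (C := fun n => Term (disk n) (disk j)) h (fun {n} f => (kappa n).comp f) (of (𝟙 _))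

end Term

open Term in
/-- `Rel f g` means that `f` and `g` are well-formed expressions whose equality follows from the
axioms of groupoidal globular extensions; in particular `Rel f f` means that `f` is well-formed, that
is, that all the families to which the universal property of globular sums is applied in `f` are
compatible. -/
inductive Rel : ∀ {S T : Theta0}, Term S T → Term S T → Prop
  | symm {S T : Theta0} {f g : Term S T} : Rel f g → Rel g f
  | trans {S T : Theta0} {f g h : Term S T} : Rel f g → Rel g h → Rel f h
  -- well-formedness and congruence
  | of {S T : Theta0} (f : S ⟶ T) : Rel (of f) (of f)
  | comp {S T U : Theta0} {f f' : Term S T} {g g' : Term T U} :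
      Rel f f' → Rel g g' → Rel (f.comp g) (f'.comp g')
  | nabla {j i : ℕ} (h : j < i) : Rel (nabla h) (nabla h)
  | kappa (i : ℕ) : Rel (kappa i) (kappa i)
  | omega {j i : ℕ} (h : j < i) : Rel (omega h) (omega h)
  | desc (T : Table) {Y : Theta0} {f f' : ∀ k : Fin (T.n + 1), Term (disk (T.top k)) Y} :
      (∀ k, Rel (f k) (f' k)) →
      (∀ l : Fin T.n, Rel ((of (σ (T.lt_left l))).comp (f l.castSucc))
        ((of (τ (T.lt_right l))).comp (f l.succ))) →
      Rel (desc T f) (desc T f')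
  -- category axioms, and functoriality of `Θ₀ → Θ̃`
  | id_comp {S T : Theta0} {f : Term S T} : Rel f f → Rel ((of (𝟙 S)).comp f) f
  | comp_id {S T : Theta0} {f : Term S T} : Rel f f → Rel (f.comp (of (𝟙 T))) f
  | assoc {S T U V : Theta0} {f : Term S T} {g : Term T U} {h : Term U V} :
      Rel f f → Rel g g → Rel h h → Rel ((f.comp g).comp h) (f.comp (g.comp h))
  | of_comp {S T U : Theta0} (f : S ⟶ T) (g : T ⟶ U) : Rel (of (f ≫ g)) ((of f).comp (of g))
  -- universal property of globular sums
  | fac (T : Table) {Y : Theta0} {f : ∀ k : Fin (T.n + 1), Term (disk (T.top k)) Y} :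
      (∀ k, Rel (f k) (f k)) →
      (∀ l : Fin T.n, Rel ((of (σ (T.lt_left l))).comp (f l.castSucc))
        ((of (τ (T.lt_right l))).comp (f l.succ))) →
      ∀ k, Rel ((of (ε T k)).comp (desc T f)) (f k)
  | hom_ext (T : Table) {Y : Theta0} {f g : Term T Y} : Rel f f → Rel g g →
      (∀ k, Rel ((of (ε T k)).comp f) ((of (ε T k)).comp g)) → Rel f g
  -- sources and targets of `∇`, `κ` and `ω`
  | σ_nabla_self (i : ℕ) : Rel ((of (σ i.lt_succ_self)).comp (nabla i.lt_succ_self))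
      ((of (σ i.lt_succ_self)).comp (of (ε (.double i.lt_succ_self) 1)))
  | τ_nabla_self (i : ℕ) : Rel ((of (τ i.lt_succ_self)).comp (nabla i.lt_succ_self))
      ((of (τ i.lt_succ_self)).comp (of (ε (.double i.lt_succ_self) 0)))
  | σ_nabla_lt {j i : ℕ} (h : j < i) :
      Rel ((of (σ i.lt_succ_self)).comp (nabla (h.trans i.lt_succ_self)))
        (nablaPair h
          ((of (σ i.lt_succ_self)).comp (of (ε (.double (h.trans i.lt_succ_self)) 0)))
          ((of (σ i.lt_succ_self)).comp (of (ε (.double (h.trans i.lt_succ_self)) 1))))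
  | τ_nabla_lt {j i : ℕ} (h : j < i) :
      Rel ((of (τ i.lt_succ_self)).comp (nabla (h.trans i.lt_succ_self)))
        (nablaPair h
          ((of (τ i.lt_succ_self)).comp (of (ε (.double (h.trans i.lt_succ_self)) 0)))
          ((of (τ i.lt_succ_self)).comp (of (ε (.double (h.trans i.lt_succ_self)) 1))))
  | σ_kappa (i : ℕ) : Rel ((of (σ i.lt_succ_self)).comp (kappa i)) (of (𝟙 (disk i)))
  | τ_kappa (i : ℕ) : Rel ((of (τ i.lt_succ_self)).comp (kappa i)) (of (𝟙 (disk i)))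
  | σ_omega_self (i : ℕ) : Rel ((of (σ i.lt_succ_self)).comp (omega i.lt_succ_self))
      (of (τ i.lt_succ_self))
  | τ_omega_self (i : ℕ) : Rel ((of (τ i.lt_succ_self)).comp (omega i.lt_succ_self))
      (of (σ i.lt_succ_self))
  | σ_omega_lt {j i : ℕ} (h : j < i) :
      Rel ((of (σ i.lt_succ_self)).comp (omega (h.trans i.lt_succ_self)))
        ((omega h).comp (of (σ i.lt_succ_self)))
  | τ_omega_lt {j i : ℕ} (h : j < i) :
      Rel ((of (τ i.lt_succ_self)).comp (omega (h.trans i.lt_succ_self)))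
        ((omega h).comp (of (τ i.lt_succ_self)))
  -- axioms of groupoidal globular extensions
  | ass {j i : ℕ} (h : j < i) :
      Rel (nablaPair h (of (ε (.triple h) 0))
          (nablaPair h (of (ε (.triple h) 1)) (of (ε (.triple h) 2))))
        (nablaPair h (nablaPair h (of (ε (.triple h) 0)) (of (ε (.triple h) 1)))
          (of (ε (.triple h) 2)))
  | exc {k j i : ℕ} (hkj : k < j) (hji : j < i) :
      Rel (nablaPair (hkj.trans hji)
          (nablaPair hji (of (ε (.quadruple hkj hji) 0)) (of (ε (.quadruple hkj hji) 1)))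
          (nablaPair hji (of (ε (.quadruple hkj hji) 2)) (of (ε (.quadruple hkj hji) 3))))
        (nablaPair hji
          (nablaPair (hkj.trans hji) (of (ε (.quadruple hkj hji) 0)) (of (ε (.quadruple hkj hji) 2)))
          (nablaPair (hkj.trans hji) (of (ε (.quadruple hkj hji) 1)) (of (ε (.quadruple hkj hji) 3))))
  | lun {j i : ℕ} (h : j < i) :
      Rel (nablaPair h ((kappas h.le).comp (of (τ h))) (of (𝟙 _))) (of (𝟙 (disk i)))
  | run {j i : ℕ} (h : j < i) :
      Rel (nablaPair h (of (𝟙 _)) ((kappas h.le).comp (of (σ h)))) (of (𝟙 (disk i)))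
  | fun_kappa {j i : ℕ} (h : j < i) :
      Rel (nablaPair (h.trans i.lt_succ_self)
          ((Term.kappa i).comp (of (ε (.double h) 0))) ((Term.kappa i).comp (of (ε (.double h) 1))))
        ((Term.kappa i).comp (Term.nabla h))
  | linv {j i : ℕ} (h : j < i) :
      Rel (nablaPair h (Term.omega h) (of (𝟙 _))) ((kappas h.le).comp (of (σ h)))
  | rinv {j i : ℕ} (h : j < i) :
      Rel (nablaPair h (of (𝟙 _)) (Term.omega h)) ((kappas h.le).comp (of (τ h)))

namespace Rel

theorem left {S T : Theta0} {f g : Term S T} (h : Rel f g) : Rel f f := h.trans h.symm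

theorem right {S T : Theta0} {f g : Term S T} (h : Rel f g) : Rel g g := h.symm.trans h

/-- Well-formed expressions, up to provable equality. -/
noncomputable def setoid (S T : Theta0) : Setoid {f : Term S T // Rel f f} where
  r f g := Rel f.1 g.1
  iseqv := ⟨fun f => f.2, fun h => h.symm, fun h h' => h.trans h'⟩

end Rel

/-- The objects of `Θ̃`: the tables of dimensions. -/
noncomputable def ThetaTilde : Type := Table

namespace ThetaTilde

/-- The morphisms of `Θ̃`. -/
noncomputable def Hom (S T : ThetaTilde) : Type := Quotient (Rel.setoid S T)

/-- The morphism of `Θ̃` defined by a well-formed expression. -/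
noncomputable def mk {S T : Theta0} (f : Term S T) (hf : Rel f f) : Hom S T := Quotient.mk (Rel.setoid S T) ⟨f, hf⟩

theorem mk_eq {S T : Theta0} {f g : Term S T} (h : Rel f g) : mk f h.left = mk g h.right :=
  Quotient.sound (s := Rel.setoid S T) h

theorem rel_of_mk_eq {S T : Theta0} {f g : Term S T} {hf : Rel f f} {hg : Rel g g}
    (h : mk f hf = mk g hg) : Rel f g :=
  Quotient.exact (s := Rel.setoid S T) h

theorem exists_mk {S T : Theta0} (f : Hom S T) : ∃ (x : Term S T) (hx : Rel x x), f = mk x hx :=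
  Quotient.inductionOn (s := Rel.setoid S T) f fun x => ⟨x.1, x.2, rfl⟩

/-- Composition of morphisms of `Θ̃`. -/
noncomputable def comp {S T U : Theta0} (f : Hom S T) (g : Hom T U) : Hom S U :=
  Quotient.liftOn₂ (s₁ := Rel.setoid S T) (s₂ := Rel.setoid T U) f g
    (fun x y => mk (x.1.comp y.1) (.comp x.2 y.2)) fun _ _ _ _ h h' => mk_eq (.comp h h')

noncomputable instance : CategoryStruct ThetaTilde where
  Hom := Hom
  id S := mk (Term.of (𝟙 (show Theta0 from S))) (.of _)
  comp f g := comp f g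

noncomputable instance : Category ThetaTilde where
  id_comp f := by
    obtain ⟨x, hx, rfl⟩ := exists_mk f
    exact mk_eq (.id_comp hx)
  comp_id f := by
    obtain ⟨x, hx, rfl⟩ := exists_mk f
    exact mk_eq (.comp_id hx)
  assoc f g h := by
    obtain ⟨x, hx, rfl⟩ := exists_mk f
    obtain ⟨y, hy, rfl⟩ := exists_mk g
    obtain ⟨z, hz, rfl⟩ := exists_mk h
    exact mk_eq (.assoc hx hy hz)

/-- The canonical functor `Θ₀ ⥤ Θ̃`, which is the identity on objects. -/
noncomputable def ofTheta0 : Theta0 ⥤ ThetaTilde where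
  obj S := S
  map f := mk (Term.of f) (.of f)
  map_id _ := rfl
  map_comp f g := mk_eq (.of_comp f g)

/-- The expression `x` is well-formed and represents the morphism `f`. -/
noncomputable def Represents {S T : Theta0} (f : ofTheta0.obj S ⟶ ofTheta0.obj T) (x : Term S T) : Prop :=
  ∃ hx : Rel x x, f = mk x hx

namespace Represents

theorem exists_term {S T : Theta0} (f : ofTheta0.obj S ⟶ ofTheta0.obj T) : ∃ x, Represents f x :=
  exists_mk f

theorem eq {S T : Theta0} {f g : ofTheta0.obj S ⟶ ofTheta0.obj T} {x y : Term S T} (hf : Represents f x)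
    (hg : Represents g y) (h : Rel x y) : f = g := by
  obtain ⟨_, rfl⟩ := hf
  obtain ⟨_, rfl⟩ := hg
  exact mk_eq h

theorem rel {S T : Theta0} {f g : ofTheta0.obj S ⟶ ofTheta0.obj T} {x y : Term S T} (hf : Represents f x)
    (hg : Represents g y) (h : f = g) : Rel x y := by
  obtain ⟨_, rfl⟩ := hf
  obtain ⟨_, rfl⟩ := hg
  exact rel_of_mk_eq h

theorem of {S T : Theta0} (f : S ⟶ T) : Represents (ofTheta0.map f) (.of f) := ⟨.of f, rfl⟩

theorem id (S : Theta0) : Represents (𝟙 (ofTheta0.obj S)) (.of (𝟙 S)) := ⟨.of _, rfl⟩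

theorem comp {S T U : Theta0} {f : ofTheta0.obj S ⟶ ofTheta0.obj T}
    {g : ofTheta0.obj T ⟶ ofTheta0.obj U} {x : Term S T} {y : Term T U} (hf : Represents f x)
    (hg : Represents g y) : Represents (f ≫ g) (x.comp y) := by
  obtain ⟨hx, rfl⟩ := hf
  obtain ⟨hy, rfl⟩ := hg
  exact ⟨.comp hx hy, rfl⟩

end Represents

/-- `Θ̃` is a globular extension under `Θ₀`. -/
theorem isGlobularExtension : IsGlobularExtension ofTheta0 := fun T => by
  have key (Y : ThetaTilde) (f : ∀ k, ofTheta0.obj (disk (T.top k)) ⟶ Y)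
      (w : ∀ l : Fin T.n, ofTheta0.map (σ (T.lt_left l)) ≫ f l.castSucc =
        ofTheta0.map (τ (T.lt_right l)) ≫ f l.succ) :
      ∃ m : ofTheta0.obj T ⟶ Y, ∀ k, ofTheta0.map (ε T k) ≫ m = f k := by
    choose x hx using fun k => Represents.exists_term (T := Y) (f k)
    have hw (l : Fin T.n) := ((Represents.of _).comp (hx l.castSucc)).rel ((Represents.of _).comp (hx l.succ)) (w l)
    have hd : Rel (.desc T x) (.desc T x) := .desc T (fun k => (hx k).1) hw
    exact ⟨mk _ hd, fun k => ((Represents.of (ε T k)).comp ⟨hd, rfl⟩).eq (hx k)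
      (.fac T (fun k => (hx k).1) hw k)⟩
  have uniq (Y : ThetaTilde) (m m' : ofTheta0.obj T ⟶ Y)
      (h : ∀ k, ofTheta0.map (ε T k) ≫ m = ofTheta0.map (ε T k) ≫ m') : m = m' := by
    obtain ⟨x, hx⟩ := Represents.exists_term (S := T) (T := Y) m
    obtain ⟨x', hx'⟩ := Represents.exists_term (S := T) (T := Y) m'
    exact hx.eq hx' (.hom_ext T hx.1 hx'.1 fun k =>
      ((Represents.of (ε T k)).comp hx).rel ((Represents.of (ε T k)).comp hx') (h k))
  choose d hd using key
  exact ⟨Multicofork.IsColimit.mk _ (fun E => d E.pt E.π E.condition)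
    (fun E k => hd E.pt E.π E.condition k)
    (fun E m hm => uniq _ _ _ fun k => (hm k).trans (hd E.pt E.π E.condition k).symm)⟩

theorem Represents.pair {j i : ℕ} (h : j < i) {Y : Theta0} {f g : ofTheta0.obj (disk i) ⟶ ofTheta0.obj Y}
    {x y : Term (disk i) Y} (hf : Represents f x) (hg : Represents g y)
    (w : ofTheta0.map (σ h) ≫ f = ofTheta0.map (τ h) ≫ g) :
    Represents (isGlobularExtension.pair h f g w) (.pair h x y) := by
  have h₁ : ∀ k : Fin 2, Rel (![x, y] k) (![x, y] k) := Fin.forall_fin_two.2 ⟨hf.1, hg.1⟩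
  have h₂ : ∀ l : Fin 1, Rel ((Term.of (σ h)).comp (![x, y] l.castSucc))
      ((Term.of (τ h)).comp (![x, y] l.succ)) := fun l => by
    obtain rfl : l = 0 := Subsingleton.elim _ _
    exact ((Represents.of _).comp hf).rel ((Represents.of _).comp hg) w
  have hd : Rel (.pair h x y) (.pair h x y) := .desc (.double h) h₁ h₂
  refine ⟨hd, isGlobularExtension.pair_ext h ?_ ?_⟩
  · rw [isGlobularExtension.fst_pair]
    exact hf.eq ((Represents.of _).comp ⟨hd, rfl⟩) (Rel.fac (.double h) h₁ h₂ 0).symm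
  · rw [isGlobularExtension.snd_pair]
    exact hg.eq ((Represents.of _).comp ⟨hd, rfl⟩) (Rel.fac (.double h) h₁ h₂ 1).symm

/-- The morphism `∇^i_j` of `Θ̃`. -/
noncomputable def nabla {j i : ℕ} (h : j < i) : ofTheta0.obj (disk i) ⟶ ofTheta0.obj (Table.double h) :=
  mk (.nabla h) (.nabla h)

/-- The morphism `κ_i` of `Θ̃`. -/
noncomputable def kappa (i : ℕ) : ofTheta0.obj (disk (i + 1)) ⟶ ofTheta0.obj (disk i) := mk (.kappa i) (.kappa i)

/-- The morphism `ω^i_j` of `Θ̃`. -/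
noncomputable def omega {j i : ℕ} (h : j < i) : ofTheta0.obj (disk i) ⟶ ofTheta0.obj (disk i) :=
  mk (.omega h) (.omega h)

theorem Represents.nabla {j i : ℕ} (h : j < i) : Represents (nabla h) (.nabla h) := ⟨.nabla h, rfl⟩

theorem Represents.kappa (i : ℕ) : Represents (kappa i) (.kappa i) := ⟨.kappa i, rfl⟩

theorem Represents.omega {j i : ℕ} (h : j < i) : Represents (omega h) (.omega h) := ⟨.omega h, rfl⟩

theorem Represents.nablaPair {j i : ℕ} (h : j < i) {Y : Theta0}
    {f g : ofTheta0.obj (disk i) ⟶ ofTheta0.obj Y} {x y : Term (disk i) Y} (hf : Represents f x)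
    (hg : Represents g y) (w : ofTheta0.map (σ h) ≫ f = ofTheta0.map (τ h) ≫ g) :
    Represents (ThetaTilde.nabla h ≫ isGlobularExtension.pair h f g w) (.nablaPair h x y) :=
  (Represents.nabla h).comp (Represents.pair h hf hg w)

open Represents in
/-- The precategorical structure of `Θ̃`. -/
noncomputable def precategorical : Precategorical isGlobularExtension where
  nabla := nabla
  kappa := kappa
  σ_nabla_self i := ((of _).comp (.nabla _)).eq ((of _).comp (of _)) (.σ_nabla_self i)
  τ_nabla_self i := ((of _).comp (.nabla _)).eq ((of _).comp (of _)) (.τ_nabla_self i)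
  σ_nabla_lt h := ((of _).comp (.nabla _)).eq
    (nablaPair h ((of _).comp (of _)) ((of _).comp (of _)) _) (.σ_nabla_lt h)
  τ_nabla_lt h := ((of _).comp (.nabla _)).eq
    (nablaPair h ((of _).comp (of _)) ((of _).comp (of _)) _) (.τ_nabla_lt h)
  σ_kappa i := ((of _).comp (.kappa i)).eq (.id _) (.σ_kappa i)
  τ_kappa i := ((of _).comp (.kappa i)).eq (.id _) (.τ_kappa i)

theorem Represents.kappas {j i : ℕ} (h : j ≤ i) : Represents (precategorical.kappas h) (.kappas h) := by
  induction i, h using Nat.le_induction with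
  | base =>
    rw [Precategorical.kappas_self, Term.kappas, Nat.leRecOn_self]
    exact .id _
  | succ i h ih =>
    rw [Precategorical.kappas_succ _ h, Term.kappas, Nat.leRecOn_succ h]
    exact (Represents.kappa i).comp ih

open Represents in
theorem isCategorical : precategorical.IsCategorical where
  ass h := (nablaPair h (of _) (nablaPair h (of _) (of _) _) _).eq
    (nablaPair h (nablaPair h (of _) (of _) _) (of _) _) (.ass h)
  exc hkj hji := (nablaPair _ (nablaPair _ (of _) (of _) _) (nablaPair _ (of _) (of _) _) _).eq
    (nablaPair _ (nablaPair _ (of _) (of _) _) (nablaPair _ (of _) (of _) _) _) (.exc hkj hji)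
  lun h := (nablaPair h ((Represents.kappas h.le).comp (of _)) (.id _) _).eq (.id _) (.lun h)
  run h := (nablaPair h (.id _) ((Represents.kappas h.le).comp (of _)) _).eq (.id _) (.run h)
  fun_kappa h := (nablaPair _ ((Represents.kappa _).comp (of _)) ((Represents.kappa _).comp (of _)) _).eq
    ((Represents.kappa _).comp (.nabla h)) (.fun_kappa h)

open Represents in
/-- The pregroupoidal structure of `Θ̃`. -/
noncomputable def pregroupoidal : Pregroupoidal isGlobularExtension where
  toPrecategorical := precategorical
  omega := omega
  σ_omega_self i := ((of _).comp (.omega _)).eq (of _) (.σ_omega_self i)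
  τ_omega_self i := ((of _).comp (.omega _)).eq (of _) (.τ_omega_self i)
  σ_omega_lt h := ((of _).comp (.omega _)).eq ((Represents.omega _).comp (of _)) (.σ_omega_lt h)
  τ_omega_lt h := ((of _).comp (.omega _)).eq ((Represents.omega _).comp (of _)) (.τ_omega_lt h)

open Represents in
/-- `Θ̃` is a groupoidal globular extension. -/
noncomputable def groupoidalExtension : GroupoidalExtension ofTheta0 where
  isGlobular := isGlobularExtension
  str := pregroupoidal
  isGroupoidal :=
    { toIsCategorical := isCategorical
      linv h := (nablaPair h (.omega h) (.id _) _).eq ((Represents.kappas h.le).comp (of _)) (.linv h)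
      rinv h := (nablaPair h (.id _) (.omega h) _).eq ((Represents.kappas h.le).comp (of _)) (.rinv h) }

end ThetaTilde

/-! ### The universal property of `Θ̃` -/

section Evaluation

variable {C : Type u} [Category.{v} C] {L : Theta0 ⥤ C} (E : GroupoidalExtension L)

open Classical in
/-- The interpretation of formal expressions in a groupoidal globular extension (undefined for
expressions involving incompatible families). -/
noncomputable def GroupoidalExtension.eval {C : Type u} [Category.{v} C] {L : Theta0 ⥤ C}
    (E : GroupoidalExtension L) : ∀ {S T : Theta0}, Term S T → Option (L.obj S ⟶ L.obj T)
  | _, _, .of f => some (L.map f)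
  | _, _, .comp f g => (eval E f).bind fun m => (eval E g).map fun n => m ≫ n
  | _, _, .nabla h => some (E.str.nabla h)
  | _, _, .kappa i => some (E.str.kappa i)
  | _, _, .omega h => some (E.str.omega h)
  | _, _, .desc T (Y := Y) f =>
      if h : ∃ g : ∀ k, L.obj (disk (T.top k)) ⟶ L.obj Y, (∀ k, eval E (f k) = some (g k)) ∧
        ∀ l : Fin T.n, L.map (σ (T.lt_left l)) ≫ g l.castSucc =
          L.map (τ (T.lt_right l)) ≫ g l.succ then
        some (E.isGlobular.desc T h.choose h.choose_spec.2) else none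

namespace GroupoidalExtension

theorem eval_of {S T : Theta0} (f : S ⟶ T) : E.eval (.of f) = some (L.map f) := by
  rw [eval]

theorem eval_id (S : Theta0) : E.eval (.of (𝟙 S)) = some (𝟙 (L.obj S)) := by
  rw [eval, L.map_id]

theorem eval_nabla {j i : ℕ} (h : j < i) : E.eval (.nabla h) = some (E.str.nabla h) := by
  rw [eval]

theorem eval_kappa (i : ℕ) : E.eval (.kappa i) = some (E.str.kappa i) := by
  rw [eval]

theorem eval_omega {j i : ℕ} (h : j < i) : E.eval (.omega h) = some (E.str.omega h) := by
  rw [eval]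

theorem eval_comp {S T U : Theta0} {f : Term S T} {g : Term T U} {m : L.obj S ⟶ L.obj T}
    {n : L.obj T ⟶ L.obj U} (hf : E.eval f = some m) (hg : E.eval g = some n) :
    E.eval (f.comp g) = some (m ≫ n) := by
  rw [eval, hf, hg]; rfl

theorem eval_comp_inv {S T U : Theta0} {f : Term S T} {g : Term T U} {p : L.obj S ⟶ L.obj U}
    (h : E.eval (f.comp g) = some p) :
    ∃ m n, E.eval f = some m ∧ E.eval g = some n ∧ p = m ≫ n := by
  rw [eval] at h
  obtain ⟨m, hm, h⟩ := Option.bind_eq_some_iff.1 h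
  obtain ⟨n, hn, h⟩ := Option.map_eq_some_iff.1 h
  exact ⟨m, n, hm, hn, h.symm⟩

theorem eval_desc_inv {T : Table} {Y : Theta0} {f : ∀ k : Fin (T.n + 1), Term (disk (T.top k)) Y}
    {m : L.obj T ⟶ L.obj Y} (h : E.eval (.desc T f) = some m) :
    ∃ g : ∀ k, L.obj (disk (T.top k)) ⟶ L.obj Y, (∀ k, E.eval (f k) = some (g k)) ∧
      ∃ w : ∀ l : Fin T.n, L.map (σ (T.lt_left l)) ≫ g l.castSucc =
        L.map (τ (T.lt_right l)) ≫ g l.succ, m = E.isGlobular.desc T g w := by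
  rw [eval] at h
  split at h
  · next h' => exact ⟨h'.choose, h'.choose_spec.1, h'.choose_spec.2, (Option.some.inj h).symm⟩
  · cases h

theorem eval_desc (T : Table) {Y : Theta0} {f : ∀ k : Fin (T.n + 1), Term (disk (T.top k)) Y}
    {g : ∀ k, L.obj (disk (T.top k)) ⟶ L.obj Y} (hf : ∀ k, E.eval (f k) = some (g k))
    (w : ∀ l : Fin T.n, L.map (σ (T.lt_left l)) ≫ g l.castSucc =
      L.map (τ (T.lt_right l)) ≫ g l.succ) :
    E.eval (.desc T f) = some (E.isGlobular.desc T g w) := by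
  rw [eval]
  split
  · next h =>
    have : h.choose = g := funext fun k => Option.some.inj ((h.choose_spec.1 k).symm.trans (hf k))
    congr 2
  · next h => exact (h ⟨g, hf, w⟩).elim

theorem eval_pair {j i : ℕ} (h : j < i) {Y : Theta0} {x y : Term (disk i) Y}
    {f g : L.obj (disk i) ⟶ L.obj Y} (hx : E.eval x = some f) (hy : E.eval y = some g)
    (w : L.map (σ h) ≫ f = L.map (τ h) ≫ g) :
    E.eval (.nablaPair h x y) = some (E.str.nabla h ≫ E.isGlobular.pair h f g w) := by
  have h₁ : ∀ k : Fin 2, E.eval (![x, y] k) = some (![f, g] k) := Fin.forall_fin_two.2 ⟨hx, hy⟩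
  exact E.eval_comp (E.eval_nabla h) (E.eval_desc (.double h) h₁ _)

theorem eval_kappas {j i : ℕ} (h : j ≤ i) : E.eval (.kappas h) = some (E.str.kappas h) := by
  induction i, h using Nat.le_induction with
  | base =>
    rw [Precategorical.kappas_self, Term.kappas, Nat.leRecOn_self]
    exact E.eval_id _
  | succ i h ih =>
    rw [Precategorical.kappas_succ _ h, Term.kappas, Nat.leRecOn_succ h]
    exact E.eval_comp (E.eval_kappa i) ih

/-- Provably equal expressions have the same (well-defined) interpretation. -/
theorem eval_sound {S T : Theta0} {x y : Term S T} (h : Rel x y) :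
    ∃ m, E.eval x = some m ∧ E.eval y = some m := by
  have of' {A B : Theta0} (f : A ⟶ B) := E.eval_of f
  have mk {A B : Theta0} {x y : Term A B} {m n : L.obj A ⟶ L.obj B} (hx : E.eval x = some m)
      (hy : E.eval y = some n) (h : m = n) : ∃ m, E.eval x = some m ∧ E.eval y = some m :=
    ⟨m, hx, h ▸ hy⟩
  have glue {T : Table} {Y : Theta0} {f : ∀ k : Fin (T.n + 1), Term (disk (T.top k)) Y}
      {g : ∀ k, L.obj (disk (T.top k)) ⟶ L.obj Y} (hf : ∀ k, E.eval (f k) = some (g k))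
      (H : ∀ l : Fin T.n, ∃ m, E.eval ((Term.of (σ (T.lt_left l))).comp (f l.castSucc)) = some m ∧
        E.eval ((Term.of (τ (T.lt_right l))).comp (f l.succ)) = some m) (l : Fin T.n) :
      L.map (σ (T.lt_left l)) ≫ g l.castSucc = L.map (τ (T.lt_right l)) ≫ g l.succ := by
    obtain ⟨m, h₁, h₂⟩ := H l
    exact (Option.some.inj ((E.eval_comp (of' _) (hf _)).symm.trans h₁)).trans
      (Option.some.inj (h₂.symm.trans (E.eval_comp (of' _) (hf _))))
  induction h with
  | symm _ ih => obtain ⟨m, h, h'⟩ := ih; exact ⟨m, h', h⟩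
  | trans _ _ ih ih' =>
    obtain ⟨m, h₁, h₂⟩ := ih
    obtain ⟨m', h₁', h₂'⟩ := ih'
    exact ⟨m, h₁, h₂'.trans (h₁'.symm.trans h₂)⟩
  | of f => exact mk (of' f) (of' f) rfl
  | comp _ _ ih ih' =>
    obtain ⟨m, h₁, h₂⟩ := ih
    obtain ⟨m', h₁', h₂'⟩ := ih'
    exact ⟨_, E.eval_comp h₁ h₁', E.eval_comp h₂ h₂'⟩
  | nabla h => exact mk (E.eval_nabla h) (E.eval_nabla h) rfl
  | kappa i => exact mk (E.eval_kappa i) (E.eval_kappa i) rfl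
  | omega h => exact mk (E.eval_omega h) (E.eval_omega h) rfl
  | desc T _ _ ih ih' =>
    choose g hg hg' using ih
    exact ⟨_, E.eval_desc T hg (glue hg ih'), E.eval_desc T hg' (glue hg ih')⟩
  | id_comp _ ih =>
    obtain ⟨m, h, _⟩ := ih
    exact mk (E.eval_comp (E.eval_id _) h) h (Category.id_comp m)
  | comp_id _ ih =>
    obtain ⟨m, h, _⟩ := ih
    exact mk (E.eval_comp h (E.eval_id _)) h (Category.comp_id m)
  | assoc _ _ _ ih₁ ih₂ ih₃ =>
    obtain ⟨m₁, h₁, _⟩ := ih₁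
    obtain ⟨m₂, h₂, _⟩ := ih₂
    obtain ⟨m₃, h₃, _⟩ := ih₃
    exact mk (E.eval_comp (E.eval_comp h₁ h₂) h₃) (E.eval_comp h₁ (E.eval_comp h₂ h₃))
      (Category.assoc _ _ _)
  | of_comp f g => exact mk (of' _) (E.eval_comp (of' f) (of' g)) (L.map_comp f g)
  | fac T _ _ k ih ih' =>
    choose g hg hg' using ih
    exact mk (E.eval_comp (of' _) (E.eval_desc T hg (glue hg ih'))) (hg k)
      (E.isGlobular.fac T g _ k)
  | hom_ext T _ _ _ ih₁ ih₂ ih =>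
    obtain ⟨m₁, h₁, _⟩ := ih₁
    obtain ⟨m₂, h₂, _⟩ := ih₂
    refine mk h₁ h₂ (E.isGlobular.hom_ext T fun k => ?_)
    obtain ⟨m, h, h'⟩ := ih k
    exact (Option.some.inj ((E.eval_comp (of' _) h₁).symm.trans h)).trans
      (Option.some.inj (h'.symm.trans (E.eval_comp (of' _) h₂)))
  | σ_nabla_self i =>
    exact mk (E.eval_comp (of' _) (E.eval_nabla _)) (E.eval_comp (of' _) (of' _))
      (E.str.σ_nabla_self i)
  | τ_nabla_self i =>
    exact mk (E.eval_comp (of' _) (E.eval_nabla _)) (E.eval_comp (of' _) (of' _))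
      (E.str.τ_nabla_self i)
  | σ_nabla_lt h =>
    exact mk (E.eval_comp (of' _) (E.eval_nabla _))
      (E.eval_pair h (E.eval_comp (of' _) (of' _)) (E.eval_comp (of' _) (of' _)) _)
      (E.str.σ_nabla_lt h)
  | τ_nabla_lt h =>
    exact mk (E.eval_comp (of' _) (E.eval_nabla _))
      (E.eval_pair h (E.eval_comp (of' _) (of' _)) (E.eval_comp (of' _) (of' _)) _)
      (E.str.τ_nabla_lt h)
  | σ_kappa i => exact mk (E.eval_comp (of' _) (E.eval_kappa i)) (E.eval_id _) (E.str.σ_kappa i)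
  | τ_kappa i => exact mk (E.eval_comp (of' _) (E.eval_kappa i)) (E.eval_id _) (E.str.τ_kappa i)
  | σ_omega_self i =>
    exact mk (E.eval_comp (of' _) (E.eval_omega _)) (of' _)
      (E.str.σ_omega_self i)
  | τ_omega_self i =>
    exact mk (E.eval_comp (of' _) (E.eval_omega _)) (of' _)
      (E.str.τ_omega_self i)
  | σ_omega_lt h =>
    exact mk (E.eval_comp (of' _) (E.eval_omega _))
      (E.eval_comp (E.eval_omega _) (of' _)) (E.str.σ_omega_lt h)
  | τ_omega_lt h =>
    exact mk (E.eval_comp (of' _) (E.eval_omega _))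
      (E.eval_comp (E.eval_omega _) (of' _)) (E.str.τ_omega_lt h)
  | ass h =>
    exact mk (E.eval_pair h (of' _) (E.eval_pair h (of' _) (of' _) _) _)
      (E.eval_pair h (E.eval_pair h (of' _) (of' _) _) (of' _) _) (E.isGroupoidal.ass h)
  | exc hkj hji =>
    exact mk
      (E.eval_pair _ (E.eval_pair _ (of' _) (of' _) _) (E.eval_pair _ (of' _) (of' _) _) _)
      (E.eval_pair _ (E.eval_pair _ (of' _) (of' _) _) (E.eval_pair _ (of' _) (of' _) _) _)
      (E.isGroupoidal.exc hkj hji)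
  | lun h =>
    exact mk
      (E.eval_pair h (E.eval_comp (E.eval_kappas h.le) (of' _)) (E.eval_id _) _) (E.eval_id _)
      (E.isGroupoidal.lun h)
  | run h =>
    exact mk
      (E.eval_pair h (E.eval_id _) (E.eval_comp (E.eval_kappas h.le) (of' _)) _) (E.eval_id _)
      (E.isGroupoidal.run h)
  | fun_kappa h =>
    exact mk
      (E.eval_pair _ (E.eval_comp (E.eval_kappa _) (of' _)) (E.eval_comp (E.eval_kappa _) (of' _)) _)
      (E.eval_comp (E.eval_kappa _) (E.eval_nabla h)) (E.isGroupoidal.fun_kappa h)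
  | linv h =>
    exact mk (E.eval_pair h (E.eval_omega h) (E.eval_id _) _)
      (E.eval_comp (E.eval_kappas h.le) (of' _)) (E.isGroupoidal.linv h)
  | rinv h =>
    exact mk (E.eval_pair h (E.eval_id _) (E.eval_omega h) _)
      (E.eval_comp (E.eval_kappas h.le) (of' _)) (E.isGroupoidal.rinv h)

/-- The action on morphisms of the functor `Θ̃ ⥤ C` attached to a groupoidal globular extension. -/
noncomputable def liftMap {S T : Theta0} (f : ThetaTilde.Hom S T) : L.obj S ⟶ L.obj T :=
  Quotient.lift (s := Rel.setoid S T) (fun x => (E.eval_sound x.2).choose) (fun x y h => by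
    obtain ⟨m, hx, hy⟩ := E.eval_sound h
    exact Option.some.inj (((E.eval_sound x.2).choose_spec.1.symm.trans hx).trans
      (hy.symm.trans (E.eval_sound y.2).choose_spec.1))) f

theorem liftMap_mk {S T : Theta0} {x : Term S T} (hx : Rel x x) {m : L.obj S ⟶ L.obj T}
    (h : E.eval x = some m) : E.liftMap (ThetaTilde.mk x hx) = m :=
  Option.some.inj ((E.eval_sound hx).choose_spec.1.symm.trans h)

/-- The functor `Θ̃ ⥤ C` attached to a groupoidal globular extension. -/
noncomputable def lift : ThetaTilde ⥤ C where
  obj S := L.obj S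
  map f := E.liftMap f
  map_id S := E.liftMap_mk _ (E.eval_id S)
  map_comp f g := by
    obtain ⟨x, hx, rfl⟩ := ThetaTilde.exists_mk f
    obtain ⟨y, hy, rfl⟩ := ThetaTilde.exists_mk g
    obtain ⟨m, hm, _⟩ := E.eval_sound hx
    obtain ⟨n, hn, _⟩ := E.eval_sound hy
    rw [E.liftMap_mk hx hm, E.liftMap_mk hy hn]
    exact E.liftMap_mk (.comp hx hy) (E.eval_comp hm hn)

end GroupoidalExtension

namespace ThetaTilde

theorem eval_eq_mk {S T : Theta0} (x : Term S T) :
    ∀ m, groupoidalExtension.eval x = some m → ∃ hx : Rel x x, m = mk x hx := by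
  induction x with
  | of f =>
    intro m h
    exact ⟨.of f, Option.some.inj (h.symm.trans (GroupoidalExtension.eval_of _ f))⟩
  | comp f g ihf ihg =>
    intro p h
    obtain ⟨m, n, hm, hn, rfl⟩ := GroupoidalExtension.eval_comp_inv _ h
    exact Represents.comp (ihf m hm) (ihg n hn)
  | nabla h =>
    intro m hm
    exact ⟨.nabla h, Option.some.inj (hm.symm.trans (GroupoidalExtension.eval_nabla _ h))⟩
  | kappa i =>
    intro m hm
    exact ⟨.kappa i, Option.some.inj (hm.symm.trans (GroupoidalExtension.eval_kappa _ i))⟩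
  | omega h =>
    intro m hm
    exact ⟨.omega h, Option.some.inj (hm.symm.trans (GroupoidalExtension.eval_omega _ h))⟩
  | desc T f ih =>
    intro m hm
    obtain ⟨g, hg, w, rfl⟩ := GroupoidalExtension.eval_desc_inv _ hm
    have hr : ∀ k, Represents (g k) (f k) := fun k => ih k (g k) (hg k)
    have hw (l : Fin T.n) :=
      ((Represents.of _).comp (hr l.castSucc)).rel ((Represents.of _).comp (hr l.succ)) (w l)
    have hd : Rel (.desc T f) (.desc T f) := .desc T (fun k => (hr k).1) hw
    refine ⟨hd, isGlobularExtension.hom_ext T fun k => ?_⟩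
    refine (IsGlobularExtension.fac _ T g w k).trans ?_
    exact (hr k).eq ((Represents.of (ε T k)).comp ⟨hd, rfl⟩) (Rel.fac T (fun k => (hr k).1) hw k).symm

/-- The universal property of `Θ̃`: for every category `C`, restriction along `Θ₀ ⥤ Θ̃` identifies
the functors `Θ̃ ⥤ C` which make `C` a globular extension under `Θ₀` with the structures of
groupoidal globular extension on `C`. -/
theorem existsUnique_lift {C : Type u} [Category.{v} C] {L : Theta0 ⥤ C}
    (E : GroupoidalExtension L) :
    ∃! F : ThetaTilde ⥤ C, ofTheta0 ⋙ F = L ∧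
      (∀ {j i : ℕ} (h : j < i), F.map (nabla h) ≍ E.str.nabla h) ∧
      (∀ i : ℕ, F.map (kappa i) ≍ E.str.kappa i) ∧
      (∀ {j i : ℕ} (h : j < i), F.map (omega h) ≍ E.str.omega h) := by
  refine ⟨E.lift, ⟨?_, fun h => ?_, fun i => ?_, fun h => ?_⟩, ?_⟩
  · exact CategoryTheory.Functor.hext (fun _ => rfl)
      (fun _ _ f => heq_of_eq (E.liftMap_mk (.of f) (E.eval_of f)))
  · exact heq_of_eq (E.liftMap_mk (.nabla h) (E.eval_nabla h))
  · exact heq_of_eq (E.liftMap_mk (.kappa i) (E.eval_kappa i))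
  · exact heq_of_eq (E.liftMap_mk (.omega h) (E.eval_omega h))
  · rintro F ⟨rfl, h₁, h₂, h₃⟩
    have key {S T : Theta0} (x : Term S T) :
        ∀ m, groupoidalExtension.eval x = some m → E.eval x = some (F.map m) := by
      induction x with
      | of f =>
        intro m h
        rw [Option.some.inj (h.symm.trans (GroupoidalExtension.eval_of _ f))]
        exact E.eval_of f
      | comp f g ihf ihg =>
        intro p h
        obtain ⟨m, n, hm, hn, rfl⟩ := GroupoidalExtension.eval_comp_inv _ h
        exact (E.eval_comp (ihf m hm) (ihg n hn)).trans (congrArg some (F.map_comp m n).symm)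
      | nabla h =>
        intro m hm
        rw [Option.some.inj (hm.symm.trans (GroupoidalExtension.eval_nabla _ h))]
        exact (E.eval_nabla h).trans (congrArg some (eq_of_heq (h₁ h)).symm)
      | kappa i =>
        intro m hm
        rw [Option.some.inj (hm.symm.trans (GroupoidalExtension.eval_kappa _ i))]
        exact (E.eval_kappa i).trans (congrArg some (eq_of_heq (h₂ i)).symm)
      | omega h =>
        intro m hm
        rw [Option.some.inj (hm.symm.trans (GroupoidalExtension.eval_omega _ h))]
        exact (E.eval_omega h).trans (congrArg some (eq_of_heq (h₃ h)).symm)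
      | desc T f ih =>
        intro m hm
        obtain ⟨g, hg, w, rfl⟩ := GroupoidalExtension.eval_desc_inv _ hm
        have w' : ∀ l : Fin T.n, (ofTheta0 ⋙ F).map (σ (T.lt_left l)) ≫ F.map (g l.castSucc) =
            (ofTheta0 ⋙ F).map (τ (T.lt_right l)) ≫ F.map (g l.succ) := fun l =>
          (F.map_comp _ _).symm.trans ((congrArg (fun f => F.map f) (w l)).trans (F.map_comp _ _))
        refine (E.eval_desc T (fun k => ih k (g k) (hg k)) w').trans (congrArg some ?_)
        refine E.isGlobular.hom_ext T fun k => (E.isGlobular.fac T _ w' k).trans ?_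
        exact (congrArg (fun f => F.map f) (IsGlobularExtension.fac _ T g w k)).symm.trans
          (F.map_comp _ _)
    refine CategoryTheory.Functor.hext (fun _ => rfl) (fun S T f => heq_of_eq ?_)
    obtain ⟨x, hx, rfl⟩ := exists_mk f
    obtain ⟨m, hm, _⟩ := groupoidalExtension.eval_sound hx
    obtain ⟨_, rfl⟩ := eval_eq_mk x m hm
    exact (E.liftMap_mk hx (key x _ hm)).symm

end ThetaTilde
end Evaluation

/-! ### The functor `Θ̃ ⥤ Mod(Θ̃) ⥤ ∞-Grpd` -/

/-- Representable presheaves are models. -/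
theorem IsGlobularExtension.isModel_yoneda {C : Type u} [Category.{0} C] {K : Theta0 ⥤ C}
    (hK : IsGlobularExtension K) (Y : C) : IsModel K (yoneda.obj Y) := fun T => by
  rw [Multifork.isLimit_types_iff]
  refine ⟨fun f g h => hK.hom_ext T fun k => ?_, fun s => ?_⟩
  · exact congrFun (congrArg MulticospanIndex.sections.val h) k
  · refine ⟨hK.desc T s.val s.property, MulticospanIndex.sections.ext (funext fun k => ?_)⟩
    exact hK.fac T s.val s.property k

/-- The functor `C ⥤ Mod(C)` induced by the Yoneda functor. -/
def GroupoidalExtension.toMod {C : Type u} [Category.{0} C] {K : Theta0 ⥤ C}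
    (E : GroupoidalExtension K) : C ⥤ Mod K :=
  (IsModel K).lift yoneda E.isGlobular.isModel_yoneda

/-- The canonical functor `Θ̃ ⥤ Mod(Θ̃) ⥤ ∞-Grpd`: the Yoneda functor followed by the functor
sending a model to its underlying strict ∞-groupoid. -/
noncomputable def ThetaTilde.toGroupoid : ThetaTilde ⥤ StrictInfGroupoid :=
  groupoidalExtension.toMod ⋙ groupoidalExtension.modToGroupoid

/-- Globular pasting schemes: the globular sets in the (essential) image of `Θ₀`. -/
def IsPastingScheme : ObjectProperty GlobularSet := Theta0.toGlobularSet.essImage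

/-- The strict ∞-groupoids which are free on a globular pasting scheme. -/
def IsFreeOnPastingScheme : ObjectProperty StrictInfGroupoid := fun Y =>
  ∃ P : GlobularSet, IsPastingScheme P ∧ StrictInfGroupoid.IsFreeOn P Y
end Globular

/-!
The composite `Θ̃ ⥤ Mod(Θ̃) ⥤ ∞-Grpd` is fully faithful because both of its factors are. For the
Yoneda functor this is clear. For the functor from models to strict ∞-groupoids, note that a model
`X` sends globular sums to limits, so that a morphism `φ` between the strict ∞-groupoids underlying
two models extends in exactly one way to a family of maps `X(S_T) → Z(S_T)` compatible with the
canonical morphisms `D_{i_k} ⟶ S_T` (`ThetaTilde.extend`). The morphisms of `Θ̃` with respect to which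
this family is natural are stable under composition and under gluing along globular sums. They
contain the morphisms of the globular category because `φ` is a morphism of globular sets, and the
`∇`, `κ` and `ω` because `φ` preserves the operations. Such morphisms generate `Θ̃`
(`ThetaTilde.hom_induction`), so the family is natural (`ThetaTilde.extend_naturality`).

A strict ∞-groupoid `Y` gives a model with value `Hom(S_T, Y)` at `T`: the functor
`S_T ↦ Hom(S_T, Y)` makes the opposite of the category of sets a globular extension, whose
groupoidal structure consists of the operations of `Y` (`StrictInfGroupoid.groupoidalExtension`), and
the universal property of `Θ̃` applies. The strict ∞-groupoid underlying this model is isomorphic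
to `Y` (`StrictInfGroupoid.modelHom`). By full faithfulness and the Yoneda lemma, the morphisms to
`Y` from the strict ∞-groupoid attached to `T` are therefore the elements of `Hom(S_T, Y)`, which is
freeness on `S_T` (`ThetaTilde.isFreeOn_toGroupoid`). The description of the essential image follows
from the uniqueness of free objects.
-/

namespace Globular

open Theta0

/-! ### Cells of globular pasting schemes -/

/-- Every cell of a globular pasting scheme lies in one of the disks of which it is the globular
sum. -/
theorem Table.exists_inj_app_eq (T : Table) {i : ℕ} (x : T.pastingScheme.cell i) :
    ∃ (k : Fin (T.n + 1)) (f : Globe.mk i ⟶ ⟨T.top k⟩), (T.inj k).app (op ⟨i⟩) f = x := by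
  obtain ⟨j, y, hy⟩ := Types.jointly_surjective _
    (isColimitOfPreserves ((evaluation Globeᵒᵖ Type).obj (op ⟨i⟩))
      (colimit.isColimit (T.diagram yoneda).multispan)) x
  cases j with
  | left l =>
    refine ⟨l.castSucc, ((T.diagram yoneda).fst l).app (op ⟨i⟩) y, ?_⟩
    rw [← hy]
    exact congrArg (fun f : yoneda.obj _ ⟶ T.pastingScheme => f.app (op ⟨i⟩) y)
      (colimit.w (T.diagram yoneda).multispan (WalkingMultispan.Hom.fst l))
  | right k => exact ⟨k, y, hy⟩

/-- A morphism of `Θ₀` from a disk to a globular sum factors through one of the summands. -/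
theorem Theta0.exists_eq_ofGlobe_map_comp_ε {T : Table} {i : ℕ} (f : disk i ⟶ (T : Theta0)) :
    ∃ (k : Fin (T.n + 1)) (g : Globe.mk i ⟶ ⟨T.top k⟩), f = ofGlobe.map g ≫ ε T k := by
  obtain ⟨k, g, hg⟩ := T.exists_inj_app_eq (yonedaEquiv (Table.diskInj i ≫ f.hom))
  refine ⟨k, g, InducedCategory.hom_ext (Table.disk_hom_ext ?_)⟩
  simp only [ε, ofGlobe, InducedCategory.comp_hom, InducedCategory.homMk_hom]
  rw [← Category.assoc, Table.diskInj_desc, Category.assoc, Table.diskInj_desc]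
  apply yonedaEquiv.injective
  rw [← hg, yonedaEquiv_apply]
  simp

theorem Theta0.ε_single (i : ℕ) : ε (.single i) 0 = 𝟙 (disk i) :=
  InducedCategory.hom_ext (Table.disk_hom_ext (by
    simp only [ε, InducedCategory.homMk_hom, InducedCategory.id_hom]
    rw [Table.diskInj_desc]
    exact (Category.comp_id _).symm))

/-! ### Generation of `Θ̃` -/

/-- The morphisms of `Θ̃` are generated by those of the globular category, the canonical morphisms
to globular sums, and `∇`, `κ` and `ω`, under composition and the universal property of globular
sums. -/
theorem ThetaTilde.hom_induction (W : MorphismProperty ThetaTilde) [W.IsStableUnderComposition]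
    (globe : ∀ {A B : Globe} (f : A ⟶ B), W (ofTheta0.map (ofGlobe.map f)))
    (ε : ∀ (T : Table) (k : Fin (T.n + 1)), W (ofTheta0.map (ε T k)))
    (nabla : ∀ {j i : ℕ} (h : j < i), W (nabla h))
    (kappa : ∀ i : ℕ, W (kappa i))
    (omega : ∀ {j i : ℕ} (h : j < i), W (omega h))
    (glue : ∀ (T : Table) {Y : ThetaTilde} (m : ofTheta0.obj T ⟶ Y),
      (∀ k, W (ofTheta0.map (Theta0.ε T k) ≫ m)) → W m)
    {S T : ThetaTilde} (m : S ⟶ T) : W m := by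
  have key {S T : Theta0} (x : Term S T) :
      ∀ m : ofTheta0.obj S ⟶ ofTheta0.obj T, groupoidalExtension.eval x = some m → W m := by
    induction x with
    | @of S T f =>
      intro m h
      obtain rfl := Option.some.inj (h.symm.trans (GroupoidalExtension.eval_of _ f))
      refine glue S _ fun k => ?_
      obtain ⟨l, g, hg⟩ := exists_eq_ofGlobe_map_comp_ε (Theta0.ε S k ≫ f)
      have e : ofTheta0.map (Theta0.ε S k) ≫ ofTheta0.map f =
          ofTheta0.map (ofGlobe.map g) ≫ ofTheta0.map (Theta0.ε T l) :=
        (ofTheta0.map_comp _ _).symm.trans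
          ((congrArg (fun f => ofTheta0.map f) hg).trans (ofTheta0.map_comp _ _))
      exact e ▸ W.comp_mem _ _ (globe g) (ε T l)
    | comp f g ihf ihg =>
      intro p h
      obtain ⟨m, n, hm, hn, rfl⟩ := GroupoidalExtension.eval_comp_inv _ h
      exact W.comp_mem _ _ (ihf m hm) (ihg n hn)
    | nabla h =>
      intro m hm
      obtain rfl := Option.some.inj (hm.symm.trans (GroupoidalExtension.eval_nabla _ h))
      exact nabla h
    | kappa i =>
      intro m hm
      obtain rfl := Option.some.inj (hm.symm.trans (GroupoidalExtension.eval_kappa _ i))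
      exact kappa i
    | omega h =>
      intro m hm
      obtain rfl := Option.some.inj (hm.symm.trans (GroupoidalExtension.eval_omega _ h))
      exact omega h
    | desc T f ih =>
      intro m hm
      obtain ⟨g, hg, w, rfl⟩ := GroupoidalExtension.eval_desc_inv _ hm
      refine glue T _ fun k => ?_
      rw [IsGlobularExtension.fac]
      exact ih k _ (hg k)
  obtain ⟨x, hx, rfl⟩ := exists_mk m
  obtain ⟨m, hm, _⟩ := groupoidalExtension.eval_sound hx
  obtain ⟨_, rfl⟩ := eval_eq_mk x m hm
  exact key x _ hm

/-! ### Models of `Θ̃` and strict ∞-groupoids -/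

namespace ThetaTilde

variable {X Z : Mod ofTheta0}
  (φ : groupoidalExtension.modToGroupoid.obj X ⟶ groupoidalExtension.modToGroupoid.obj Z)

/-- The action on `i`-arrows of a morphism between strict ∞-groupoids underlying models. -/
def cellMap (i : ℕ) (u : X.obj.obj (op (ofTheta0.obj (disk i)))) :
    Z.obj.obj (op (ofTheta0.obj (disk i))) :=
  (φ.map.app (op (Globe.mk i)) : _ → _) u

theorem cellMap_globe {A B : Globe} (f : A ⟶ B) (u : X.obj.obj (op (ofTheta0.obj (disk B.dim)))) :
    cellMap φ A.dim (X.obj.map (ofTheta0.map (ofGlobe.map f)).op u) =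
      Z.obj.map (ofTheta0.map (ofGlobe.map f)).op (cellMap φ B.dim u) :=
  NatTrans.naturality_apply φ.map f.op u

/-- The extension to all globular sums of a morphism between strict ∞-groupoids underlying
models: models send globular sums to limits, so that it is determined by its action on the disks. -/
noncomputable def extend (T : Table) (z : X.obj.obj (op (ofTheta0.obj T))) :
    Z.obj.obj (op (ofTheta0.obj T)) :=
  Z.property.glue T (fun k => cellMap φ (T.top k) (X.obj.map (ofTheta0.map (ε T k)).op z)) fun l =>
    (cellMap_globe φ (Globe.σ (T.lt_left l)) _).symm.trans
      ((congrArg _ (IsModel.map_map_eq (map_ε_glue ofTheta0 T l) X.obj z)).trans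
        (cellMap_globe φ (Globe.τ (T.lt_right l)) _))

theorem map_ε_extend (T : Table) (z : X.obj.obj (op (ofTheta0.obj T))) (k : Fin (T.n + 1)) :
    Z.obj.map (ofTheta0.map (ε T k)).op (extend φ T z) =
      cellMap φ (T.top k) (X.obj.map (ofTheta0.map (ε T k)).op z) :=
  Z.property.map_ε_glue T _ _ k

theorem extend_disk (i : ℕ) (u : X.obj.obj (op (ofTheta0.obj (disk i)))) :
    extend φ (disk i) u = cellMap φ i u := by
  have h := map_ε_extend φ (.single i) u 0
  rw [ε_single, ofTheta0.map_id] at h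
  exact (IsModel.map_id_op _ _).trans (h.trans (congrArg _ (IsModel.map_id_op _ u).symm))

/-- The morphisms of `Θ̃` with respect to which `extend φ` is natural. -/
def naturalityProperty : MorphismProperty ThetaTilde := fun S T m =>
  ∀ z : X.obj.obj (op T), extend φ S (X.obj.map m.op z) = Z.obj.map m.op (extend φ T z)

instance : (naturalityProperty φ).IsStableUnderComposition where
  comp_mem f g hf hg z :=
    (congrArg _ (IsModel.map_comp_op X.obj f g z)).trans ((hf _).trans
      ((congrArg _ (hg z)).trans (IsModel.map_comp_op Z.obj f g _).symm))

/-- Compatibility with the operations of strict ∞-groupoids amounts to naturality with respect to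
`∇`, `κ` and `ω`, and hence with respect to all morphisms of `Θ̃`. -/
theorem extend_naturality {S T : ThetaTilde} (m : S ⟶ T) : naturalityProperty φ m := by
  refine hom_induction _ (fun {A B} f z => ?_) (fun T k z => ?_) (fun {j i} h z => ?_)
    (fun i z => ?_) (fun {j i} h z => ?_) (fun T Y m hm z => ?_) m
  · exact (extend_disk φ _ _).trans ((cellMap_globe φ f z).trans
      (congrArg _ (extend_disk φ _ z).symm))
  · exact (extend_disk φ _ _).trans (map_ε_extend φ T z k).symm
  · refine (extend_disk φ _ _).trans ?_
    have w := IsModel.map_map_eq (double_glue ofTheta0 h) X.obj z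
    refine Eq.trans ?_ ((φ.map_comp h (X.obj.map (ofTheta0.map (ε (.double h) 0)).op z)
      (X.obj.map (ofTheta0.map (ε (.double h) 1)).op z) w).trans ?_)
    · exact congrArg (fun z => cellMap φ i (X.obj.map (nabla h).op z))
        (X.property.eq_pair h _ _ w z rfl rfl).symm
    · refine congrArg (Z.obj.map (nabla h).op) (Z.property.eq_pair h _ _ _ _ ?_ ?_)
      · exact map_ε_extend φ (.double h) z 0
      · exact map_ε_extend φ (.double h) z 1
  · exact (extend_disk φ _ _).trans ((φ.map_unit i z).trans (congrArg _ (extend_disk φ _ z).symm))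
  · exact (extend_disk φ _ _).trans ((φ.map_inv h z).trans (congrArg _ (extend_disk φ _ z).symm))
  · refine Z.property.ext T fun k => ?_
    refine (map_ε_extend φ T _ k).trans ?_
    rw [← IsModel.map_comp_op]
    exact (extend_disk φ _ _).symm.trans ((hm k z).trans (IsModel.map_comp_op Z.obj _ m _))

instance : groupoidalExtension.modToGroupoid.Full where
  map_surjective {X Z} φ := by
    refine ⟨ObjectProperty.homMk
      { app := fun T => ↾(extend φ T.unop)
        naturality := fun T S m => by
          ext z
          exact extend_naturality φ m.unop z }, ?_⟩
    apply StrictInfGroupoid.Hom.ext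
    ext A u
    exact extend_disk φ A.unop.dim u

instance : groupoidalExtension.modToGroupoid.Faithful where
  map_injective {X Z} f g h := by
    apply ObjectProperty.hom_ext
    ext T z
    refine Z.property.ext T.unop fun k => ?_
    have := congrArg (fun φ => φ.map.app (op ⟨T.unop.top k⟩)
      (X.obj.map (ofTheta0.map (ε T.unop k)).op z)) h
    exact (NatTrans.naturality_apply f.hom (ofTheta0.map (ε T.unop k)).op z).symm.trans
      (this.trans (NatTrans.naturality_apply g.hom (ofTheta0.map (ε T.unop k)).op z))

instance : (groupoidalExtension.toMod).Full :=
  inferInstanceAs ((IsModel ofTheta0).lift yoneda _).Full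

instance : (groupoidalExtension.toMod).Faithful :=
  inferInstanceAs ((IsModel ofTheta0).lift yoneda _).Faithful

instance : toGroupoid.Full :=
  inferInstanceAs (groupoidalExtension.toMod ⋙ groupoidalExtension.modToGroupoid).Full

instance : toGroupoid.Faithful :=
  inferInstanceAs (groupoidalExtension.toMod ⋙ groupoidalExtension.modToGroupoid).Faithful

end ThetaTilde

/-! ### The model of `Θ̃` attached to a strict ∞-groupoid -/

namespace GlobularSet

variable {X : GlobularSet}

/-- The `i`-arrow of `X` classified by a morphism `D_i ⟶ X`, the disk `D_i` being regarded as an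
object of `Θ₀`. -/
noncomputable def diskEquiv (i : ℕ) : ((Table.single i).pastingScheme ⟶ X) ≃ X.cell i where
  toFun f := yonedaEquiv (Table.diskInj i ≫ f)
  invFun u := Table.diskDesc (yonedaEquiv.symm u)
  left_inv f := Table.disk_hom_ext (by rw [Table.diskInj_desc, Equiv.symm_apply_apply])
  right_inv u := (congrArg _ (Table.diskInj_desc _)).trans (yonedaEquiv.apply_symm_apply u)

theorem diskInj_ofGlobe {A B : Globe} (g : A ⟶ B) (f : (Table.single B.dim).pastingScheme ⟶ X) :
    Table.diskInj A.dim ≫ (ofGlobe.map g).hom ≫ f = yoneda.map g ≫ Table.diskInj B.dim ≫ f := by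
  rw [← Category.assoc]
  exact (congrArg (· ≫ f) (Table.diskInj_desc _)).trans (Category.assoc _ _ _)

theorem diskInj_ε (T : Table) (k : Fin (T.n + 1)) (f : T.pastingScheme ⟶ X) :
    Table.diskInj (T.top k) ≫ (ε T k).hom ≫ f = T.inj k ≫ f := by
  rw [← Category.assoc]
  exact congrArg (· ≫ f) (Table.diskInj_desc _)

theorem diskEquiv_ofGlobe {A B : Globe} (g : A ⟶ B) (f : (Table.single B.dim).pastingScheme ⟶ X) :
    diskEquiv A.dim ((ofGlobe.map g).hom ≫ f) = X.map g.op (diskEquiv B.dim f) :=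
  (congrArg _ (diskInj_ofGlobe g f)).trans
    (yonedaEquiv_naturality (Table.diskInj B.dim ≫ f) g).symm

theorem diskEquiv_ε (T : Table) (k : Fin (T.n + 1)) (f : T.pastingScheme ⟶ X) :
    diskEquiv (T.top k) ((ε T k).hom ≫ f) = yonedaEquiv (T.inj k ≫ f) :=
  congrArg (fun g => yonedaEquiv g) (diskInj_ε T k f)

variable (X) in
/-- The functor `S_T ↦ Hom(S_T, X)`, with values in the opposite of the category of sets. -/
noncomputable def homFunctor : Theta0 ⥤ Typeᵒᵖ := (Theta0.toGlobularSet.op ⋙ yoneda.obj X).rightOp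

/-- `Hom(-, X)` sends globular sums to limits of sets, that is, to globular sums in the opposite
category. -/
theorem isGlobularExtension_homFunctor : IsGlobularExtension (homFunctor X) := fun T => by
  have w (E : Multicofork (T.diagram (ofGlobe ⋙ homFunctor X))) (e : E.pt.unop) (l : Fin T.n) :
      yoneda.map (Globe.σ (T.lt_left l)) ≫ Table.diskInj _ ≫ (E.π l.castSucc).unop e =
        yoneda.map (Globe.τ (T.lt_right l)) ≫ Table.diskInj _ ≫ (E.π l.succ).unop e := by
    have h := congrArg (fun f => Table.diskInj (T.bot l) ≫ f.unop e) (E.condition l)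
    exact (diskInj_ofGlobe (Globe.σ (T.lt_left l)) _).symm.trans
      (h.trans (diskInj_ofGlobe (Globe.τ (T.lt_right l)) _))
  refine ⟨Multicofork.IsColimit.mk _
    (fun E => (↾(fun e => T.desc (fun k => Table.diskInj _ ≫ (E.π k).unop e) (w E e))).op) ?_ ?_⟩
  · intro E k
    apply Quiver.Hom.unop_inj
    ext e
    refine Table.disk_hom_ext ?_
    exact (diskInj_ε T k _).trans (T.inj_desc _ (w E e) k)
  · intro E m hm
    apply Quiver.Hom.unop_inj
    ext e
    refine T.hom_ext fun k => ?_
    have h := congrArg (fun f => Table.diskInj (T.top k) ≫ f.unop e) (hm k)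
    exact (diskInj_ε T k _).symm.trans (h.trans
      (T.inj_desc (fun k => Table.diskInj _ ≫ (E.π k).unop e) (w E e) k).symm)

section arrow

variable {i : ℕ} {Z : Typeᵒᵖ}

/-- A morphism from the disk `D_i` to `Z` in the opposite of the category of sets, under
`homFunctor X`, is a family of `i`-arrows of `X` indexed by `Z`; this is the arrow of index `z`. -/
noncomputable def arrow (f : (homFunctor X).obj (disk i) ⟶ Z) (z : Z.unop) : X.cell i :=
  diskEquiv i (f.unop z)

theorem arrow_ext {f g : (homFunctor X).obj (disk i) ⟶ Z} (h : ∀ z, arrow f z = arrow g z) :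
    f = g := by
  apply Quiver.Hom.unop_inj
  ext z
  exact (diskEquiv i).injective (h z)

theorem arrow_comp {Z' : Typeᵒᵖ} (f : (homFunctor X).obj (disk i) ⟶ Z) (g : Z ⟶ Z') (z : Z'.unop) :
    arrow (f ≫ g) z = arrow f (g.unop z) := rfl

theorem arrow_σ {j : ℕ} (h : j < i) (f : (homFunctor X).obj (disk i) ⟶ Z) (z : Z.unop) :
    arrow ((homFunctor X).map (σ h) ≫ f) z = X.src h (arrow f z) :=
  diskEquiv_ofGlobe (Globe.σ h) _

theorem arrow_τ {j : ℕ} (h : j < i) (f : (homFunctor X).obj (disk i) ⟶ Z) (z : Z.unop) :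
    arrow ((homFunctor X).map (τ h) ≫ f) z = X.tgt h (arrow f z) :=
  diskEquiv_ofGlobe (Globe.τ h) _

theorem src_arrow_eq {j : ℕ} {h : j < i} {f g : (homFunctor X).obj (disk i) ⟶ Z}
    (w : (homFunctor X).map (σ h) ≫ f = (homFunctor X).map (τ h) ≫ g) (z : Z.unop) :
    X.src h (arrow f z) = X.tgt h (arrow g z) := by
  rw [← arrow_σ, w, arrow_τ]

end arrow

end GlobularSet

namespace StrictInfGroupoid

open GlobularSet

variable (Y : StrictInfGroupoid)

/-- A function from the `i'`-arrows to the `i`-arrows of `Y`, regarded as a morphism from `D_i` to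
`D_{i'}` in the opposite of the category of sets, under `homFunctor Y.cells`. -/
noncomputable def diskMap {i i' : ℕ} (φ : Y.cells.cell i' → Y.cells.cell i) :
    (homFunctor Y.cells).obj (disk i) ⟶ (homFunctor Y.cells).obj (disk i') :=
  (↾(fun z => (diskEquiv i).symm (φ (diskEquiv i' z)))).op

theorem arrow_diskMap {i i' : ℕ} (φ : Y.cells.cell i' → Y.cells.cell i) {Z : Typeᵒᵖ}
    (f : (homFunctor Y.cells).obj (disk i') ⟶ Z) (z : Z.unop) :
    arrow (Y.diskMap φ ≫ f) z = φ (arrow f z) :=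
  (diskEquiv i).apply_symm_apply _

theorem arrow_diskMap' {i i' : ℕ} (φ : Y.cells.cell i' → Y.cells.cell i) (z) :
    arrow (Y.diskMap φ) z = φ (diskEquiv i' z) :=
  (diskEquiv i).apply_symm_apply _

/-- The morphism `∇^i_j` dual to the composition `*^i_j` of `Y`. -/
noncomputable def nabla {j i : ℕ} (h : j < i) :
    (homFunctor Y.cells).obj (disk i) ⟶ (homFunctor Y.cells).obj (Table.double h) :=
  (↾(fun z => (diskEquiv i).symm (Y.str.comp h
    (arrow ((homFunctor Y.cells).map (ε (.double h) 0)) z)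
    (arrow ((homFunctor Y.cells).map (ε (.double h) 1)) z)
    (src_arrow_eq (double_glue _ h) z)))).op

theorem arrow_nabla {j i : ℕ} (h : j < i) (z) :
    arrow (Y.nabla h) z = Y.str.comp h
      (arrow ((homFunctor Y.cells).map (ε (.double h) 0)) z)
      (arrow ((homFunctor Y.cells).map (ε (.double h) 1)) z)
      (src_arrow_eq (double_glue _ h) z) :=
  (diskEquiv i).apply_symm_apply _

theorem arrow_nabla_pair {j i : ℕ} (h : j < i) {Z : Typeᵒᵖ}
    (f g : (homFunctor Y.cells).obj (disk i) ⟶ Z)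
    (w : (homFunctor Y.cells).map (σ h) ≫ f = (homFunctor Y.cells).map (τ h) ≫ g) (z : Z.unop) :
    arrow (Y.nabla h ≫ isGlobularExtension_homFunctor.pair h f g w) z =
      Y.str.comp h (arrow f z) (arrow g z) (src_arrow_eq w z) := by
  rw [arrow_comp, arrow_nabla]
  refine Y.str.comp_congr h ?_ ?_ _
  · rw [← arrow_comp, IsGlobularExtension.fst_pair]
  · rw [← arrow_comp, IsGlobularExtension.snd_pair]

/-- The precategorical structure on the globular extension `homFunctor Y.cells`, dual to the
compositions and units of `Y`. -/
noncomputable def precategorical :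
    Precategorical (isGlobularExtension_homFunctor (X := Y.cells)) where
  nabla := Y.nabla
  kappa i := Y.diskMap (Y.str.unit i)
  σ_nabla_self i := arrow_ext fun z => by
    rw [arrow_σ, arrow_nabla, Y.str.src_comp_self, arrow_σ]
  τ_nabla_self i := arrow_ext fun z => by
    rw [arrow_τ, arrow_nabla, Y.str.tgt_comp_self, arrow_τ]
  σ_nabla_lt h := arrow_ext fun z => by
    rw [arrow_σ, arrow_nabla, Y.str.src_comp_lt, arrow_nabla_pair]
    exact Y.str.comp_congr h (arrow_σ _ _ _).symm (arrow_σ _ _ _).symm _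
  τ_nabla_lt h := arrow_ext fun z => by
    rw [arrow_τ, arrow_nabla, Y.str.tgt_comp_lt, arrow_nabla_pair]
    exact Y.str.comp_congr h (arrow_τ _ _ _).symm (arrow_τ _ _ _).symm _
  σ_kappa i := arrow_ext fun z => by
    rw [arrow_σ, arrow_diskMap', Y.str.src_unit]; rfl
  τ_kappa i := arrow_ext fun z => by
    rw [arrow_τ, arrow_diskMap', Y.str.tgt_unit]; rfl

theorem arrow_kappas {j i : ℕ} (h : j ≤ i) {Z : Typeᵒᵖ}
    (f : (homFunctor Y.cells).obj (disk j) ⟶ Z) (z : Z.unop) :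
    arrow (Y.precategorical.kappas h ≫ f) z = Y.str.units h (arrow f z) := by
  induction i, h using Nat.le_induction with
  | base => rw [Precategorical.kappas_self, Category.id_comp, InfPrecategory.units_self]
  | succ i h ih =>
    rw [Precategorical.kappas_succ _ h, InfPrecategory.units_succ _ h, ← ih, Category.assoc]
    exact Y.arrow_diskMap _ _ _

theorem isCategorical : Y.precategorical.IsCategorical where
  ass h := arrow_ext fun z => by
    have H := Y.isStrict.ass h _ _ _
      (src_arrow_eq (triple_glue₀₁ (homFunctor Y.cells) h) z)
      (src_arrow_eq (triple_glue₁₂ (homFunctor Y.cells) h) z)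
    refine (Y.arrow_nabla_pair h _ _ _ z).trans (Eq.trans ?_ (H.symm.trans (Eq.trans ?_
      (Y.arrow_nabla_pair h _ _ _ z).symm)))
    · exact Y.str.comp_congr h rfl (Y.arrow_nabla_pair h _ _ _ z) _
    · exact Y.str.comp_congr h (Y.arrow_nabla_pair h _ _ _ z).symm rfl _
  exc hkj hji := arrow_ext fun z => by
    have H := Y.isStrict.exc hkj hji _ _ _ _
      (src_arrow_eq (quadruple_glue₀₁ (homFunctor Y.cells) hkj hji) z)
      (src_arrow_eq (quadruple_glue₁₂ (homFunctor Y.cells) hkj hji) z)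
      (src_arrow_eq (quadruple_glue₂₃ (homFunctor Y.cells) hkj hji) z)
    refine (Y.arrow_nabla_pair _ _ _ _ z).trans (Eq.trans ?_ (H.trans (Eq.trans ?_
      (Y.arrow_nabla_pair _ _ _ _ z).symm)))
    · exact Y.str.comp_congr _ (Y.arrow_nabla_pair _ _ _ _ z) (Y.arrow_nabla_pair _ _ _ _ z) _
    · exact Y.str.comp_congr _ (Y.arrow_nabla_pair _ _ _ _ z).symm
        (Y.arrow_nabla_pair _ _ _ _ z).symm _
  lun {j i} h := arrow_ext fun z => by
    refine (Y.arrow_nabla_pair _ _ _ _ z).trans (Eq.trans ?_ (Y.isStrict.lun h (arrow (𝟙 _) z)))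
    refine Y.str.comp_congr _ ?_ rfl _
    rw [arrow_kappas, ← arrow_τ, Category.comp_id]
  run h := arrow_ext fun z => by
    refine (Y.arrow_nabla_pair _ _ _ _ z).trans (Eq.trans ?_ (Y.isStrict.run h (arrow (𝟙 _) z)))
    refine Y.str.comp_congr _ rfl ?_ _
    rw [arrow_kappas, ← arrow_σ, Category.comp_id]
  fun_kappa h := arrow_ext fun z => by
    refine (Y.arrow_nabla_pair _ _ _ _ z).trans (Eq.trans ?_ ((Y.isStrict.fun_unit h _ _
      (src_arrow_eq (double_glue (homFunctor Y.cells) h) z)).symm.trans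
      (Eq.trans ?_ (Y.arrow_diskMap _ _ _).symm)))
    · exact Y.str.comp_congr _ (Y.arrow_diskMap _ _ _) (Y.arrow_diskMap _ _ _) _
    · exact congrArg _ (Y.arrow_nabla h z).symm

/-- The pregroupoidal structure on the globular extension `homFunctor Y.cells`, dual to the
compositions, units and inverses of `Y`. -/
noncomputable def pregroupoidal :
    Pregroupoidal (isGlobularExtension_homFunctor (X := Y.cells)) where
  toPrecategorical := Y.precategorical
  omega h := Y.diskMap (Y.str.inv h)
  σ_omega_self i := arrow_ext fun z => by
    rw [arrow_σ, arrow_diskMap', Y.str.src_inv_self]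
    exact (diskEquiv_ofGlobe _ _).symm
  τ_omega_self i := arrow_ext fun z => by
    rw [arrow_τ, arrow_diskMap', Y.str.tgt_inv_self]
    exact (diskEquiv_ofGlobe _ _).symm
  σ_omega_lt h := arrow_ext fun z => by
    rw [arrow_σ, arrow_diskMap', Y.str.src_inv_lt, arrow_diskMap]
    exact congrArg _ (diskEquiv_ofGlobe _ _).symm
  τ_omega_lt h := arrow_ext fun z => by
    rw [arrow_τ, arrow_diskMap', Y.str.tgt_inv_lt, arrow_diskMap]
    exact congrArg _ (diskEquiv_ofGlobe _ _).symm

/-- The groupoidal globular extension `S_T ↦ Hom(S_T, Y)`, in the opposite of the category of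
sets, attached to a strict ∞-groupoid `Y`. -/
noncomputable def groupoidalExtension : GroupoidalExtension (homFunctor Y.cells) where
  isGlobular := isGlobularExtension_homFunctor
  str := Y.pregroupoidal
  isGroupoidal :=
    { toIsCategorical := Y.isCategorical
      linv := fun h => arrow_ext fun z => by
        refine (Y.arrow_nabla_pair _ _ _ _ z).trans (Eq.trans ?_
          ((Y.isStrict.linv h (arrow (𝟙 _) z)).trans ?_))
        · exact Y.str.comp_congr _ (Y.arrow_diskMap' _ z) rfl _
        · refine Eq.trans ?_ (Y.arrow_kappas h.le _ z).symm
          rw [← arrow_σ, Category.comp_id]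
      rinv := fun h => arrow_ext fun z => by
        refine (Y.arrow_nabla_pair _ _ _ _ z).trans (Eq.trans ?_
          ((Y.isStrict.rinv h (arrow (𝟙 _) z)).trans ?_))
        · exact Y.str.comp_congr _ rfl (Y.arrow_diskMap' _ z) _
        · refine Eq.trans ?_ (Y.arrow_kappas h.le _ z).symm
          rw [← arrow_τ, Category.comp_id] }

end StrictInfGroupoid

namespace StrictInfGroupoid

open GlobularSet

variable (Y : StrictInfGroupoid)

/-- The presheaf on `Θ̃` induced by `Y`: the universal property of `Θ̃` extends the presheaf
`S_T ↦ Hom(S_T, Y)` from `Θ₀` to `Θ̃`. -/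
noncomputable def presheaf : ThetaTildeᵒᵖ ⥤ Type := Y.groupoidalExtension.lift.leftOp

theorem presheaf_map_ofTheta0 {S T : Theta0} (f : S ⟶ T) (z : T.pastingScheme ⟶ Y.cells) :
    Y.presheaf.map (ThetaTilde.ofTheta0.map f).op z = f.hom ≫ z :=
  congrArg (fun m : (homFunctor Y.cells).obj S ⟶ (homFunctor Y.cells).obj T => m.unop z)
    (Y.groupoidalExtension.liftMap_mk (.of f) (Y.groupoidalExtension.eval_of f))

theorem presheaf_map_nabla {j i : ℕ} (h : j < i)
    (z : (Table.double h).pastingScheme ⟶ Y.cells) :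
    Y.presheaf.map (ThetaTilde.nabla h).op z = (Y.nabla h).unop z :=
  congrArg (fun m : (homFunctor Y.cells).obj _ ⟶ (homFunctor Y.cells).obj _ => m.unop z)
    (Y.groupoidalExtension.liftMap_mk (.nabla h) (Y.groupoidalExtension.eval_nabla h))

theorem presheaf_map_kappa (i : ℕ) (z : (Table.single i).pastingScheme ⟶ Y.cells) :
    Y.presheaf.map (ThetaTilde.kappa i).op z = (Y.diskMap (Y.str.unit i)).unop z :=
  congrArg (fun m : (homFunctor Y.cells).obj _ ⟶ (homFunctor Y.cells).obj _ => m.unop z)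
    (Y.groupoidalExtension.liftMap_mk (.kappa i) (Y.groupoidalExtension.eval_kappa i))

theorem presheaf_map_omega {j i : ℕ} (h : j < i) (z : (Table.single i).pastingScheme ⟶ Y.cells) :
    Y.presheaf.map (ThetaTilde.omega h).op z = (Y.diskMap (Y.str.inv h)).unop z :=
  congrArg (fun m : (homFunctor Y.cells).obj _ ⟶ (homFunctor Y.cells).obj _ => m.unop z)
    (Y.groupoidalExtension.liftMap_mk (.omega h) (Y.groupoidalExtension.eval_omega h))

theorem isModel_presheaf : IsModel ThetaTilde.ofTheta0 Y.presheaf := fun T => by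
  rw [Multifork.isLimit_types_iff]
  refine ⟨fun f g h => T.hom_ext fun k => ?_, fun s => ?_⟩
  · have := congrFun (congrArg MulticospanIndex.sections.val h) k
    have := (Y.presheaf_map_ofTheta0 (ε T k) f).symm.trans
      (this.trans (Y.presheaf_map_ofTheta0 (ε T k) g))
    exact (diskInj_ε T k f).symm.trans ((congrArg (Table.diskInj _ ≫ ·) this).trans
      (diskInj_ε T k g))
  · have w (l : Fin T.n) :
        yoneda.map (Globe.σ (T.lt_left l)) ≫ Table.diskInj _ ≫ s.val l.castSucc =
          yoneda.map (Globe.τ (T.lt_right l)) ≫ Table.diskInj _ ≫ s.val l.succ := by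
      have h := (Y.presheaf_map_ofTheta0 (σ (T.lt_left l)) _).symm.trans
        ((s.property l).trans (Y.presheaf_map_ofTheta0 (τ (T.lt_right l)) _))
      exact (diskInj_ofGlobe (Globe.σ (T.lt_left l)) _).symm.trans
        ((congrArg (Table.diskInj _ ≫ ·) h).trans (diskInj_ofGlobe (Globe.τ (T.lt_right l)) _))
    refine ⟨T.desc (fun k => Table.diskInj _ ≫ s.val k) w,
      MulticospanIndex.sections.ext (funext fun k => ?_)⟩
    refine (Y.presheaf_map_ofTheta0 (ε T k) _).trans (Table.disk_hom_ext ?_)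
    exact (diskInj_ε T k _).trans (T.inj_desc _ w k)

/-- The model of `Θ̃` attached to a strict ∞-groupoid. -/
noncomputable def model : Mod ThetaTilde.ofTheta0 := ⟨Y.presheaf, Y.isModel_presheaf⟩

/-- The strict ∞-groupoid underlying the model attached to `Y` is isomorphic to `Y`: this is the
comparison morphism, which identifies a morphism `D_i ⟶ Y` with an `i`-arrow of `Y`. -/
noncomputable def modelHom :
    ThetaTilde.groupoidalExtension.modToGroupoid.obj Y.model ⟶ Y where
  map :=
    { app := fun A => ↾(fun z : (Table.single A.unop.dim).pastingScheme ⟶ Y.cells =>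
        diskEquiv A.unop.dim z)
      naturality := fun A B g => by
        ext z
        exact (congrArg (diskEquiv B.unop.dim)
          (Y.presheaf_map_ofTheta0 (ofGlobe.map g.unop) z)).trans (diskEquiv_ofGlobe g.unop z) }
  map_comp {j i} h u v w := by
    refine (congrArg (diskEquiv i) (Y.presheaf_map_nabla h _)).trans ((Y.arrow_nabla h _).trans ?_)
    refine Y.str.comp_congr h (congrArg (diskEquiv i) ?_) (congrArg (diskEquiv i) ?_) _
    · exact (Y.presheaf_map_ofTheta0 _ _).symm.trans (Y.isModel_presheaf.fst_pair h u v w)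
    · exact (Y.presheaf_map_ofTheta0 _ _).symm.trans (Y.isModel_presheaf.snd_pair h u v w)
  map_unit i u :=
    (congrArg (diskEquiv (i + 1)) (Y.presheaf_map_kappa i u)).trans (Y.arrow_diskMap' _ u)
  map_inv {j i} h u :=
    (congrArg (diskEquiv i) (Y.presheaf_map_omega h u)).trans (Y.arrow_diskMap' _ u)

/-- A morphism of strict ∞-groupoids which is an isomorphism of globular sets is an isomorphism. -/
instance : forget.ReflectsIsomorphisms where
  reflects {X Y} f hf := by
    have : IsIso f.map := hf
    have inv_app (A : Globeᵒᵖ) (y : Y.cells.obj A) : f.map.app A ((inv f.map).app A y) = y :=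
      congrArg (fun g : Y.cells ⟶ Y.cells => g.app A y) (IsIso.inv_hom_id f.map)
    have inj (A : Globeᵒᵖ) {x y : X.cells.obj A} (h : f.map.app A x = f.map.app A y) : x = y := by
      have key (x : X.cells.obj A) : (inv f.map).app A (f.map.app A x) = x :=
        congrArg (fun g : X.cells ⟶ X.cells => g.app A x) (IsIso.hom_inv_id f.map)
      rw [← key x, h, key]
    let g : Y ⟶ X :=
      { map := inv f.map
        map_comp := fun {j i} h u v w => inj _ ((inv_app _ _).trans
          ((Y.str.comp_congr h (inv_app _ u).symm (inv_app _ v).symm w).trans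
            (f.map_comp h _ _ _).symm))
        map_unit := fun i u => inj _ ((inv_app _ _).trans
          ((congrArg _ (inv_app _ u).symm).trans (f.map_unit i _).symm))
        map_inv := fun h u => inj _ ((inv_app _ _).trans
          ((congrArg _ (inv_app _ u).symm).trans (f.map_inv h _).symm)) }
    exact ⟨g, Hom.ext (IsIso.hom_inv_id f.map), Hom.ext (IsIso.inv_hom_id f.map)⟩

instance : IsIso Y.modelHom := by
  have (A : Globeᵒᵖ) : IsIso (Y.modelHom.map.app A) :=
    (isIso_iff_bijective _).2 (diskEquiv A.unop.dim).bijective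
  have : IsIso (forget.map Y.modelHom) := NatIso.isIso_of_isIso_app Y.modelHom.map
  exact isIso_of_reflects_iso _ forget

/-! ### Free strict ∞-groupoids on globular pasting schemes -/

theorem IsFreeOn.of_iso {P Q : GlobularSet} {X Y : StrictInfGroupoid} (h : IsFreeOn P X)
    (e : P ≅ Q) (e' : X ≅ Y) : IsFreeOn Q Y := by
  obtain ⟨η, ⟨hη⟩⟩ := h
  refine ⟨e.inv ≫ η ≫ forget.map e'.hom, ⟨IsInitial.ofUniqueHom
    (fun A => StructuredArrow.homMk (e'.inv ≫ (hη.to (StructuredArrow.mk (e.hom ≫ A.hom))).right)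
      ?_) fun A m => ?_⟩⟩
  · have := StructuredArrow.w (hη.to (StructuredArrow.mk (e.hom ≫ A.hom)))
    dsimp at this
    simp [← Functor.map_comp_assoc, this]
  · have hm := StructuredArrow.w m
    have := hη.hom_ext (hη.to (StructuredArrow.mk (e.hom ≫ A.hom)))
      (StructuredArrow.homMk (e'.hom ≫ m.right) (by rw [← hm]; simp))
    ext
    simp [this]

theorem IsFreeOn.nonempty_iso {P : GlobularSet} {X Y : StrictInfGroupoid} (hX : IsFreeOn P X)
    (hY : IsFreeOn P Y) : Nonempty (X ≅ Y) := by
  obtain ⟨η, ⟨hη⟩⟩ := hX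
  obtain ⟨η', ⟨hη'⟩⟩ := hY
  exact ⟨(StructuredArrow.proj P forget).mapIso (hη.uniqueUpToIso hη')⟩

end StrictInfGroupoid

namespace ThetaTilde

open GlobularSet

/-- The canonical morphism from `S_T` to the strict ∞-groupoid attached to `T`. -/
noncomputable def generators (T : Table) :
    T.pastingScheme ⟶ (toGroupoid.obj (ofTheta0.obj T)).cells :=
  T.desc (fun k => yonedaEquiv.symm (ofTheta0.map (ε T k))) fun l => by
    apply yonedaEquiv.injective
    rw [← yonedaEquiv_naturality, ← yonedaEquiv_naturality]
    have key (k : Fin (T.n + 1)) : yonedaEquiv (F := (toGroupoid.obj (ofTheta0.obj T)).cells)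
        (yonedaEquiv.symm (ofTheta0.map (ε T k))) = ofTheta0.map (ε T k) :=
      Equiv.apply_symm_apply _ _
    exact (congrArg _ (key l.castSucc)).trans ((map_ε_glue ofTheta0 T l).trans
      (congrArg ((toGroupoid.obj (ofTheta0.obj T)).cells.map (Globe.τ (T.lt_right l)).op)
        (key l.succ)).symm)

theorem yonedaEquiv_inj_generators (T : Table) {Y : StrictInfGroupoid}
    (g : toGroupoid.obj (ofTheta0.obj T) ⟶ Y) (k : Fin (T.n + 1)) :
    yonedaEquiv (T.inj k ≫ generators T ≫ g.map) =
      g.map.app (op ⟨T.top k⟩) (ofTheta0.map (ε T k)) := by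
  rw [← Category.assoc, generators, T.inj_desc, yonedaEquiv_comp]
  exact congrArg _ (Equiv.apply_symm_apply _ _)

/-- The strict ∞-groupoid attached to `T` is free on `S_T`: by the Yoneda lemma and the full
faithfulness of the functor from models to strict ∞-groupoids, its morphisms to `Y` are the elements
at `T` of the model attached to `Y`, that is, the morphisms `S_T ⟶ Y`. -/
theorem isFreeOn_toGroupoid (T : Table) :
    StrictInfGroupoid.IsFreeOn T.pastingScheme (toGroupoid.obj (ofTheta0.obj T)) := by
  have exist (Y : StrictInfGroupoid) (f : T.pastingScheme ⟶ Y.cells) :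
      ∃ g : toGroupoid.obj (ofTheta0.obj T) ⟶ Y, generators T ≫ g.map = f := by
    -- By the Yoneda lemma, `f` is a morphism to the model attached to `Y`.
    let α : groupoidalExtension.toMod.obj (ofTheta0.obj T) ⟶ Y.model :=
      ObjectProperty.homMk ((yonedaEquiv (X := ofTheta0.obj T) (F := Y.presheaf)).symm f)
    refine ⟨groupoidalExtension.modToGroupoid.map α ≫ Y.modelHom, T.hom_ext fun k => ?_⟩
    apply yonedaEquiv.injective
    rw [yonedaEquiv_inj_generators, ← diskEquiv_ε]
    exact congrArg (diskEquiv (T.top k)) (Y.presheaf_map_ofTheta0 (ε T k) f)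
  have uniq (Y : StrictInfGroupoid) (g g' : toGroupoid.obj (ofTheta0.obj T) ⟶ Y)
      (h : generators T ≫ g.map = generators T ≫ g'.map) : g = g' := by
    obtain ⟨α, hα⟩ := groupoidalExtension.modToGroupoid.map_surjective (g ≫ inv Y.modelHom)
    obtain ⟨α', hα'⟩ := groupoidalExtension.modToGroupoid.map_surjective (g' ≫ inv Y.modelHom)
    suffices α = α' by
      exact (cancel_mono (inv Y.modelHom)).1
        (hα.symm.trans ((congrArg groupoidalExtension.modToGroupoid.map this).trans hα'))
    apply ObjectProperty.hom_ext
    apply (yonedaEquiv (X := ofTheta0.obj T) (F := Y.presheaf)).injective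
    refine Y.isModel_presheaf.ext T fun k => ?_
    have key (β : groupoidalExtension.toMod.obj (ofTheta0.obj T) ⟶ Y.model) :
        Y.presheaf.map (ofTheta0.map (ε T k)).op (yonedaEquiv (F := Y.presheaf) β.hom) =
          (groupoidalExtension.modToGroupoid.map β).map.app (op ⟨T.top k⟩)
            (ofTheta0.map (ε T k)) :=
      (yonedaEquiv_naturality (F := Y.presheaf) β.hom (ofTheta0.map (ε T k))).trans
        ((yonedaEquiv_comp _ _).trans (congrArg _ (yonedaEquiv_yoneda_map _)))
    have h' := congrArg (fun f => yonedaEquiv (T.inj k ≫ f)) h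
    rw [yonedaEquiv_inj_generators, yonedaEquiv_inj_generators] at h'
    refine (key α).trans (Eq.trans ?_ (key α').symm)
    rw [hα, hα']
    exact congrArg ((inv Y.modelHom).map.app _) h'
  choose lift hlift using exist
  exact ⟨generators T, ⟨IsInitial.ofUniqueHom
    (fun A => StructuredArrow.homMk (lift A.right A.hom) (hlift _ _))
    fun A m => StructuredArrow.hom_ext _ _ (uniq _ _ _
      ((StructuredArrow.w m).trans (hlift A.right A.hom).symm))⟩⟩

theorem isFreeOnPastingScheme_toGroupoid (S : ThetaTilde) :
    IsFreeOnPastingScheme (toGroupoid.obj S) :=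
  ⟨_, Theta0.toGlobularSet.obj_mem_essImage S, isFreeOn_toGroupoid S⟩

theorem essImage_toGroupoid : toGroupoid.essImage = IsFreeOnPastingScheme := by
  ext Y
  constructor
  · rintro ⟨S, ⟨e⟩⟩
    exact ⟨_, Theta0.toGlobularSet.obj_mem_essImage S,
      (isFreeOn_toGroupoid S).of_iso (Iso.refl _) e⟩
  · rintro ⟨P, ⟨T, ⟨e⟩⟩, hY⟩
    exact ⟨ofTheta0.obj T, ((isFreeOn_toGroupoid T).of_iso e (Iso.refl _)).nonempty_iso hY⟩

end ThetaTilde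

end Globular

theorem mainTheorem5 :
    Globular.ThetaTilde.toGroupoid.Full ∧
    Globular.ThetaTilde.toGroupoid.Faithful ∧
    (∀ T : Globular.Table,
      Globular.StrictInfGroupoid.IsFreeOn T.pastingScheme
        (Globular.ThetaTilde.toGroupoid.obj (Globular.ThetaTilde.ofTheta0.obj T))) ∧
    Globular.ThetaTilde.toGroupoid.essImage = Globular.IsFreeOnPastingScheme ∧
    ∃ h : ∀ S : Globular.ThetaTilde,
        Globular.IsFreeOnPastingScheme (Globular.ThetaTilde.toGroupoid.obj S),
      (Globular.IsFreeOnPastingScheme.lift Globular.ThetaTilde.toGroupoid h).IsEquivalence := by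
  refine ⟨inferInstance, inferInstance, Globular.ThetaTilde.isFreeOn_toGroupoid,
    Globular.ThetaTilde.essImage_toGroupoid,
    Globular.ThetaTilde.isFreeOnPastingScheme_toGroupoid, { essSurj := ⟨fun Y => ?_⟩ }⟩
  obtain ⟨S, ⟨e⟩⟩ : Globular.ThetaTilde.toGroupoid.essImage Y.obj :=
    Globular.ThetaTilde.essImage_toGroupoid.symm.le _ Y.property
  exact ⟨S, ⟨ObjectProperty.isoMk _ e⟩⟩
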